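/- Let $J=[0,+\infty)$ and let $\mathcal L(\mathbb R^n)$ be the space of real $n\times n$ matrices, with the operator norm induced by a norm $\|\cdot\|$ on $\mathbb R^n$. Let $A\colon J\to\mathcal L(\mathbb R^n)$ be of bounded variation on every compact subinterval of $J$, and suppose that $I-(A(t)-A(t^-))$ is invertible for every $t>0$ and that $I+(A(t^+)-A(t))$ is invertible for every $t\ge 0$. For $a\le b$, a function $G\colon[a,b]\times[a,b]\to X$ with values in a normed space $X$ has Kurzweil integral $\int_a^b DG(\tau,t)=\mathcal I\in X$ if for every $\varepsilon>0$ there is a function $\delta\colon[a,b]\to(0,\infty)$ such that $$\Big\|\sum_{j=1}^{\nu}\big[G(\tau_j,\alpha_j)-G(\tau_j,\alpha_{j-1})\big]-\mathcal I\Big\|<\varepsilon$$ for all $a=\alpha_0<\alpha_1<\dots<\alpha_\nu=b$ and $\tau_j\in[\alpha_{j-1},\alpha_j]$ with $[\alpha_{j-1},\alpha_j]\subset(\tau_j-\delta(\tau_j),\tau_j+\delta(\tau_j))$ for $j=1,\dots,\nu$; moreover $\int_b^a=-\int_a^b$ and $\int_a^a=0$. A function $x\colon[s_0,+\infty)\to\mathbb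 R^n$, $s_0\ge0$, is a solution on $[s_0,+\infty)$ of the homogeneous generalized linear differential equation (GLDE) $\frac{dx}{d\tau}=D[A(t)x]$ if $x(d)-x(c)=\int_c^d D[A(t)x(\tau)]$ whenever $s_0\le c\le d$. The trivial solution $x\equiv0$ is uniformly stable if for every $\varepsilon>0$ there is $\delta>0$ such that, for every $s_0\ge0$ and $x_0\in\mathbb R^n$ with $\|x_0\|<\delta$, the solution $x$ on $[s_0,+\infty)$ with $x(s_0)=x_0$ satisfies $\|x(t)\|<\varepsilon$ for all $t\ge s_0$. Then there is a unique function $U\colon J\times J\to\mathcal L(\mathbb R^n)$, the transition matrix of the GLDE, such that $$U(t,s)=I+\int_s^t D[A(r)U(\tau,s)]\qquad\text{for all }t,s\in J,$$ where the integral is the Kurzweil integral of $G(\tau,r)=A(r)U(\tau,s)$; and the trivial solution of the GLDE is uniformly stable if and only if there is a constant $C$ with $\|U(t,s_0)\|\le C$ for all $t\ge s_0\ge 0$. -/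

import Mathlib

open Set

namespace GLDE

/-- A tagged partition `{([α_j, α_{j+1}], τ_j) : j < ν}` of the interval `[a, b]`, that is
`a = α_0 < α_1 < ⋯ < α_ν = b` and `τ_j ∈ [α_j, α_{j+1}]`. Only the values `pt j` for `j ≤ ν`
and `tag j` for `j < ν` matter. For `a = b` the only partition has `ν = 0`. -/
structure TaggedPartition (a b : ℝ) where
  /-- the number of subintervals -/
  ν : ℕ
  /-- the division points -/
  pt : ℕ → ℝ
  /-- the tags -/
  tag : ℕ → ℝ
  pt_zero : pt 0 = a
  pt_last : pt ν = b
  pt_lt : ∀ j < ν, pt j < pt (j + 1)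
  tag_mem : ∀ j < ν, tag j ∈ Icc (pt j) (pt (j + 1))

/-- `δ` is a gauge on `[a, b]`. -/
def IsGauge (δ : ℝ → ℝ) (a b : ℝ) : Prop :=
  ∀ t ∈ Icc a b, 0 < δ t

/-- `δ`-fineness: `[α_j, α_{j+1}] ⊆ (τ_j - δ(τ_j), τ_j + δ(τ_j))` for every `j`. -/
def TaggedPartition.IsFine {a b : ℝ} (P : TaggedPartition a b) (δ : ℝ → ℝ) : Prop :=
  ∀ j < P.ν, Icc (P.pt j) (P.pt (j + 1)) ⊆
    Ioo (P.tag j - δ (P.tag j)) (P.tag j + δ (P.tag j))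

section Integral

variable {X : Type*} [NormedAddCommGroup X]

/-- The sum `∑_j [G(τ_j, α_{j+1}) - G(τ_j, α_j)]`. -/
def TaggedPartition.kurzweilSum {a b : ℝ} (P : TaggedPartition a b) (G : ℝ → ℝ → X) : X :=
  ∑ j ∈ Finset.range P.ν, (G (P.tag j) (P.pt (j + 1)) - G (P.tag j) (P.pt j))

/-- For `a ≤ b`: the function `G` is Kurzweil integrable on `[a, b]` with integral `I`. -/
def HasKurzweilIntegral (G : ℝ → ℝ → X) (a b : ℝ) (I : X) : Prop :=
  ∀ ε : ℝ, 0 < ε → ∃ δ : ℝ → ℝ, IsGauge δ a b ∧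
    ∀ P : TaggedPartition a b, P.IsFine δ → ‖P.kurzweilSum G - I‖ < ε

/-- The oriented Kurzweil integral from `a` to `b` exists and equals `I`, with the convention
`∫_a^b = -∫_b^a` when `b < a`. -/
def HasOrientedKurzweilIntegral (G : ℝ → ℝ → X) (a b : ℝ) (I : X) : Prop :=
  (a ≤ b → HasKurzweilIntegral G a b I) ∧ (b < a → HasKurzweilIntegral G b a (-I))

end Integral

section Equation

variable {E : Type*} [NormedAddCommGroup E] [NormedSpace ℝ E]

/-- The jump condition on the coefficient `A : [0, ∞) → L(E)`: `I - Δ⁻A(t)` is invertible for all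
`t > 0` and `I + Δ⁺A(t)` is invertible for all `t ≥ 0`, where `Δ⁻A(t) = A(t) - A(t⁻)` and
`Δ⁺A(t) = A(t⁺) - A(t)`. -/
def ConditionD (A : ℝ → E →L[ℝ] E) : Prop :=
  (∀ t : ℝ, 0 < t → IsUnit (1 - (A t - Function.leftLim A t))) ∧
  (∀ t : ℝ, 0 ≤ t → IsUnit (1 + (Function.rightLim A t - A t)))

/-- `x` is a solution of the homogeneous equation `dx/dτ = D[A(t)x]` on the interval `J`:
`x(d) - x(c) = ∫_c^d D[A(t)x(τ)]` whenever `[c, d] ⊆ J`. -/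
def IsSolutionOn (A : ℝ → E →L[ℝ] E) (J : Set ℝ) (x : ℝ → E) : Prop :=
  ∀ c d : ℝ, c ≤ d → Icc c d ⊆ J →
    HasKurzweilIntegral (fun τ t => A t (x τ)) c d (x d - x c)

/-- `U` is a transition matrix of `dx/dτ = D[A(t)x]` on `[0, ∞)`:
`U(t, s) = I + ∫_s^t d[A(r)] U(r, s)` for all `t, s ≥ 0`. -/
def IsTransitionMatrix (A : ℝ → E →L[ℝ] E) (U : ℝ → ℝ → E →L[ℝ] E) : Prop :=
  ∀ t s : ℝ, 0 ≤ t → 0 ≤ s →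
    HasOrientedKurzweilIntegral (fun τ r => A r ∘L U τ s) s t
      (U t s - ContinuousLinearMap.id ℝ E)

/-- The trivial solution of `dx/dτ = D[A(t)x]` on `[0, ∞)` is uniformly stable. -/
def UniformlyStable (A : ℝ → E →L[ℝ] E) : Prop :=
  ∀ ε : ℝ, 0 < ε → ∃ δ : ℝ, 0 < δ ∧ ∀ s₀ : ℝ, 0 ≤ s₀ → ∀ x₀ : E, ‖x₀‖ < δ →
    ∀ x : ℝ → E, IsSolutionOn A (Ici s₀) x → x s₀ = x₀ → ∀ t ≥ s₀, ‖x t‖ < ε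

end Equation

end GLDE

/-!
Dominate the increments of `A` by those of a nondecreasing function `μ`. A solution in the sense of
the Kurzweil integral is then the same as a function `x` with
`x u - x τ - (A u - A τ) (x τ) = o(|μ u - μ τ|)` as `u → τ`, for every `τ`: the errors in a Kurzweil
sum add up to at most `ε` times the total increment of `μ`. For this local equation one works with
`ε`-approximate solutions. Such a function grows, forwards or backwards, by a bounded factor near
any point: the invertible jump at the point contributes a bounded factor, and away from the jump
the variation of `μ` is small. Cousin's compactness argument turns this into a growth bound on every
compact interval, which gives uniqueness. Explicit approximate solutions near a point (jump, then
one Euler step) are glued together by the same compactness argument, and the growth bound makes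
them converge as `ε → 0`.

The matrix equation is the same equation in the space of operators, so it has a unique solution `U`,
and `U(t, s) v` is the solution through `(s, v)`. Uniform stability then says exactly that the
operators `U(t, s)` map a fixed ball into the unit ball, that is, that they are uniformly bounded.
-/

namespace GLDE

open Filter Topology

section OneSided

/-- `l` is one of the two punctured one-sided neighbourhood filters `𝓝[<] t`, `𝓝[>] t`. All local
arguments are run along such a filter, which treats both sides of `t` at once. -/
def IsSide (l : Filter ℝ) (t : ℝ) : Prop :=
  l = 𝓝[<] t ∨ l = 𝓝[>] t

variable {l : Filter ℝ} {t : ℝ} {J : Set ℝ}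

theorem isSide_left (t : ℝ) : IsSide (𝓝[<] t) t := Or.inl rfl

theorem isSide_right (t : ℝ) : IsSide (𝓝[>] t) t := Or.inr rfl

theorem IsSide.neBot (hl : IsSide l t) : l.NeBot := by
  rcases hl with rfl | rfl <;> infer_instance

theorem IsSide.le_nhdsWithin (hl : IsSide l t) (hJ : J ∈ l) : l ≤ 𝓝[J] t := by
  refine le_inf ?_ (le_principal_iff.2 hJ)
  rcases hl with rfl | rfl <;> exact nhdsWithin_le_nhds

theorem IsSide.eventually_ne (hl : IsSide l t) : ∀ᶠ u in l, u ≠ t := by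
  rcases hl with rfl | rfl
  exacts [eventually_mem_nhdsWithin.mono fun _ hu => (mem_Iio.1 hu).ne,
    eventually_mem_nhdsWithin.mono fun _ hu => (mem_Ioi.1 hu).ne']

theorem IsSide.exists_tendsto (hl : IsSide l t) {μ : ℝ → ℝ} (hμ : Monotone μ) :
    ∃ m, Tendsto μ l (𝓝 m) := by
  rcases hl with rfl | rfl
  exacts [⟨_, hμ.tendsto_leftLim t⟩, ⟨_, hμ.tendsto_rightLim t⟩]

theorem IsSide.eventually_forall_uIcc (hl : IsSide l t) {p : ℝ → Prop} (hp : ∀ᶠ u in l, p u) :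
    ∀ᶠ v in l, ∀ u ∈ uIcc t v, u ≠ t → p u := by
  rcases hl with rfl | rfl
  · obtain ⟨c, hc, h⟩ := mem_nhdsLT_iff_exists_Ioo_subset.1 hp
    filter_upwards [Ioo_mem_nhdsLT hc] with v hv u hu hut
    rw [uIcc_of_ge hv.2.le] at hu
    exact h ⟨hv.1.trans_le hu.1, lt_of_le_of_ne hu.2 hut⟩
  · obtain ⟨c, hc, h⟩ := mem_nhdsGT_iff_exists_Ioo_subset.1 hp
    filter_upwards [Ioo_mem_nhdsGT hc] with v hv u hu hut
    rw [uIcc_of_le hv.1.le] at hu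
    exact h ⟨lt_of_le_of_ne hu.1 hut.symm, hu.2.trans_lt hv.2⟩

theorem IsSide.eventually_uIcc_mem (hl : IsSide l t) : ∀ᶠ v in l, uIcc t v ∈ l := by
  rcases hl with rfl | rfl
  · filter_upwards [self_mem_nhdsWithin] with v hv
    exact mem_of_superset (Ioo_mem_nhdsLT hv) (by
      rw [uIcc_of_ge (le_of_lt hv)]; exact Ioo_subset_Icc_self)
  · filter_upwards [self_mem_nhdsWithin] with v hv
    exact mem_of_superset (Ioo_mem_nhdsGT hv) (by
      rw [uIcc_of_le (le_of_lt hv)]; exact Ioo_subset_Icc_self)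

theorem eventually_nhdsWithin_of_forall_isSide [J.OrdConnected] (ht : t ∈ J) {p : ℝ → Prop}
    (hpt : p t) (hp : ∀ l, IsSide l t → J ∈ l → ∀ᶠ u in l, p u) : ∀ᶠ u in 𝓝[J] t, p u := by
  have side : ∀ l, IsSide l t → ∀ᶠ u in l, u ∈ J → p u := fun l hl => by
    by_cases hJ : J ∈ l
    · exact (hp l hl hJ).mono fun u hu _ => hu
    have hJ' : ∀ᶠ u in l, u ∉ J := by
      by_contra h
      obtain ⟨u, hu, hul⟩ := ((not_eventually.1 h).and_eventually hl.eventually_uIcc_mem).exists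
      exact hJ (mem_of_superset hul (OrdConnected.uIcc_subset ‹_› ht (not_not.1 hu)))
    exact hJ'.mono fun u hu huJ => absurd huJ hu
  rw [eventually_nhdsWithin_iff, ← pure_sup_nhdsNE, ← nhdsLT_sup_nhdsGT, eventually_sup,
    eventually_sup, eventually_pure]
  exact ⟨fun _ => hpt, side _ (isSide_left t), side _ (isSide_right t)⟩

end OneSided

theorem interval_induction {P : ℝ → ℝ → Prop} {a b : ℝ} (hab : a ≤ b) (refl : P a a)
    (trans : ∀ u v w, a ≤ u → u ≤ v → v ≤ w → w ≤ b → P u v → P v w → P u w)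
    (left : ∀ t ∈ Ioc a b, ∀ᶠ u in 𝓝[<] t, P u t)
    (right : ∀ t ∈ Ico a b, ∀ᶠ v in 𝓝[>] t, P t v) : P a b := by
  let S : Set ℝ := {t | t ∈ Icc a b ∧ P a t}
  have haS : a ∈ S := ⟨left_mem_Icc.2 hab, refl⟩
  have hbdd : BddAbove S := ⟨b, fun t ht => ht.1.2⟩
  obtain ⟨s, hs⟩ : ∃ s, IsLUB S s := ⟨_, isLUB_csSup ⟨a, haS⟩ hbdd⟩
  have has : a ≤ s := hs.1 haS
  have hsb : s ≤ b := hs.2 fun t ht => ht.1.2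
  have hPs : P a s := by
    rcases has.eq_or_lt with rfl | has'
    · exact refl
    obtain ⟨c, hcs, hc⟩ := mem_nhdsLT_iff_exists_Ioo_subset.1 (left s ⟨has', hsb⟩)
    obtain ⟨t, htS, hct, hts⟩ := hs.exists_between hcs
    rcases hts.eq_or_lt with rfl | hts
    · exact htS.2
    exact trans a t s le_rfl htS.1.1 hts.le hsb htS.2 (hc ⟨hct, hts⟩)
  rcases hsb.eq_or_lt with rfl | hsb'
  · exact hPs
  obtain ⟨v, hPv, hsv, hvb⟩ := ((right s ⟨has, hsb'⟩).and (Ioo_mem_nhdsGT hsb')).exists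
  exact absurd (hs.1 ⟨⟨has.trans hsv.le, hvb.le⟩,
    trans a s v le_rfl has hsv.le hvb.le hPs hPv⟩) hsv.not_ge

/-! ### Tagged partitions and the Kurzweil integral -/

namespace TaggedPartition

variable {a b c : ℝ}

theorem pt_mono (P : TaggedPartition a b) {i j : ℕ} (hij : i ≤ j) (hj : j ≤ P.ν) :
    P.pt i ≤ P.pt j := by
  induction j, hij using Nat.le_induction with
  | base => exact le_rfl
  | succ k _ ih => exact (ih (by omega)).trans (P.pt_lt k (by omega)).le

theorem pt_mem_Icc (P : TaggedPartition a b) {j : ℕ} (hj : j ≤ P.ν) : P.pt j ∈ Icc a b :=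
  ⟨P.pt_zero.ge.trans (P.pt_mono j.zero_le hj), (P.pt_mono hj le_rfl).trans P.pt_last.le⟩

theorem tag_mem_Icc (P : TaggedPartition a b) {j : ℕ} (hj : j < P.ν) : P.tag j ∈ Icc a b :=
  ⟨(P.pt_mem_Icc hj.le).1.trans (P.tag_mem j hj).1,
    (P.tag_mem j hj).2.trans (P.pt_mem_Icc (show j + 1 ≤ P.ν from hj)).2⟩

/-- The partition of a degenerate interval. -/
def refl (a : ℝ) : TaggedPartition a a where
  ν := 0
  pt _ := a
  tag _ := a
  pt_zero := rfl
  pt_last := rfl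
  pt_lt _ h := absurd h (Nat.not_lt_zero _)
  tag_mem _ h := absurd h (Nat.not_lt_zero _)

/-- The partition obtained by putting the tagged interval `([a, b], τ)` in front of a partition of
`[b, c]`. -/
def cons {τ : ℝ} (hab : a < b) (hτ : τ ∈ Icc a b) (P : TaggedPartition b c) :
    TaggedPartition a c where
  ν := P.ν + 1
  pt
    | 0 => a
    | j + 1 => P.pt j
  tag
    | 0 => τ
    | j + 1 => P.tag j
  pt_zero := rfl
  pt_last := P.pt_last
  pt_lt
    | 0, _ => hab.trans_eq P.pt_zero.symm
    | j + 1, hj => P.pt_lt j (Nat.lt_of_succ_lt_succ hj)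
  tag_mem
    | 0, _ => ⟨hτ.1, hτ.2.trans_eq P.pt_zero.symm⟩
    | j + 1, hj => P.tag_mem j (Nat.lt_of_succ_lt_succ hj)

theorem isFine_refl (a : ℝ) (δ : ℝ → ℝ) : (refl a).IsFine δ := fun _ h =>
  absurd h (Nat.not_lt_zero _)

theorem IsFine.cons {τ : ℝ} {δ : ℝ → ℝ} {P : TaggedPartition b c} (hP : P.IsFine δ) (hab : a < b)
    (hτ : τ ∈ Icc a b) (hδ : Icc a b ⊆ Ioo (τ - δ τ) (τ + δ τ)) : (P.cons hab hτ).IsFine δ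
  | 0, _ => by simpa only [TaggedPartition.cons, P.pt_zero] using hδ
  | j + 1, hj => hP j (Nat.lt_of_succ_lt_succ hj)

theorem IsFine.mono {P : TaggedPartition a b} {δ δ' : ℝ → ℝ} (hP : P.IsFine δ)
    (h : ∀ t, δ t ≤ δ' t) : P.IsFine δ' := fun j hj =>
  (hP j hj).trans (Ioo_subset_Ioo (by linarith [h (P.tag j)]) (by linarith [h (P.tag j)]))

variable {X : Type*} [NormedAddCommGroup X]

theorem kurzweilSum_refl (a : ℝ) (G : ℝ → ℝ → X) : (refl a).kurzweilSum G = 0 :=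
  Finset.sum_range_zero _

theorem kurzweilSum_cons {τ : ℝ} (hab : a < b) (hτ : τ ∈ Icc a b) (P : TaggedPartition b c)
    (G : ℝ → ℝ → X) :
    (P.cons hab hτ).kurzweilSum G = G τ b - G τ a + P.kurzweilSum G := by
  rw [kurzweilSum, show (P.cons hab hτ).ν = P.ν + 1 from rfl, Finset.sum_range_succ', add_comm]
  exact congrArg (fun p => G τ p - G τ a + P.kurzweilSum G) P.pt_zero

theorem exists_isFine_kurzweilSum_add {δ : ℝ → ℝ} {P : TaggedPartition a b}
    {Q : TaggedPartition b c} (hP : P.IsFine δ) (hQ : Q.IsFine δ) (G : ℝ → ℝ → X) :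
    ∃ R : TaggedPartition a c,
      R.IsFine δ ∧ R.kurzweilSum G = P.kurzweilSum G + Q.kurzweilSum G := by
  suffices h : ∀ j ≤ P.ν, ∃ R : TaggedPartition (P.pt j) c, R.IsFine δ ∧ R.kurzweilSum G =
      ∑ i ∈ Finset.Ico j P.ν, (G (P.tag i) (P.pt (i + 1)) - G (P.tag i) (P.pt i)) +
        Q.kurzweilSum G by
    have h0 := h 0 (Nat.zero_le _)
    rwa [P.pt_zero, Nat.Ico_zero_eq_range] at h0
  intro j hj
  induction hj using Nat.decreasingInduction with
  | self =>
    rw [P.pt_last, Finset.Ico_self, Finset.sum_empty]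
    exact ⟨Q, hQ, (zero_add _).symm⟩
  | of_succ j hj ih =>
    obtain ⟨R, hR, hRG⟩ := ih
    refine ⟨R.cons (P.pt_lt j hj) (P.tag_mem j hj), hR.cons _ _ (hP j hj), ?_⟩
    rw [kurzweilSum_cons, hRG, ← add_assoc, Finset.sum_eq_sum_Ico_succ_bot hj]

/-- Cousin's lemma. -/
theorem exists_isFine (hab : a ≤ b) {δ : ℝ → ℝ} (hδ : IsGauge δ a b) :
    ∃ P : TaggedPartition a b, P.IsFine δ := by
  have single : ∀ {u v τ}, u < v → τ ∈ Icc u v → τ - δ τ < u → v < τ + δ τ →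
      ∃ P : TaggedPartition u v, P.IsFine δ := fun {_ v _} huv hτ h₁ h₂ =>
    ⟨_, (isFine_refl v δ).cons huv hτ (Icc_subset_Ioo h₁ h₂)⟩
  refine interval_induction (P := fun u v => ∃ P : TaggedPartition u v, P.IsFine δ) hab
    ⟨refl a, isFine_refl a δ⟩ ?_ (fun t ht => ?_) fun t ht => ?_
  · rintro u v w - - - - ⟨P, hP⟩ ⟨Q, hQ⟩
    obtain ⟨R, hR, -⟩ := exists_isFine_kurzweilSum_add hP hQ (0 : ℝ → ℝ → ℝ)
    exact ⟨R, hR⟩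
  · have hδt : 0 < δ t := hδ t ⟨ht.1.le, ht.2⟩
    filter_upwards [Ioo_mem_nhdsLT (sub_lt_self t hδt)] with u hu
    exact single hu.2 (right_mem_Icc.2 hu.2.le) hu.1 (lt_add_of_pos_right t hδt)
  · have hδt : 0 < δ t := hδ t ⟨ht.1, ht.2.le⟩
    filter_upwards [Ioo_mem_nhdsGT (lt_add_of_pos_right t hδt)] with v hv
    exact single hv.1 (left_mem_Icc.2 hv.1.le) (sub_lt_self t hδt) hv.2

theorem norm_kurzweilSum_sub_le (P : TaggedPartition a b) {G : ℝ → ℝ → X} {F : ℝ → X}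
    {m : ℝ → ℝ} (h : ∀ j < P.ν, ‖G (P.tag j) (P.pt (j + 1)) - G (P.tag j) (P.pt j) -
      (F (P.pt (j + 1)) - F (P.pt j))‖ ≤ m (P.pt (j + 1)) - m (P.pt j)) :
    ‖P.kurzweilSum G - (F b - F a)‖ ≤ m b - m a := by
  have hF : F b - F a = ∑ j ∈ Finset.range P.ν, (F (P.pt (j + 1)) - F (P.pt j)) := by
    rw [Finset.sum_range_sub (fun j => F (P.pt j)), P.pt_zero, P.pt_last]
  have hm : m b - m a = ∑ j ∈ Finset.range P.ν, (m (P.pt (j + 1)) - m (P.pt j)) := by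
    rw [Finset.sum_range_sub (fun j => m (P.pt j)), P.pt_zero, P.pt_last]
  rw [hF, hm, kurzweilSum, ← Finset.sum_sub_distrib]
  exact norm_sum_le_of_le _ fun j hj => h j (Finset.mem_range.1 hj)

end TaggedPartition

section Integral

variable {X : Type*} [NormedAddCommGroup X] {G : ℝ → ℝ → X} {F : ℝ → X} {a b c : ℝ} {I I' : X}

theorem IsGauge.min {δ δ' : ℝ → ℝ} (h : IsGauge δ a b) (h' : IsGauge δ' a b) :
    IsGauge (fun t => min (δ t) (δ' t)) a b := fun t ht => lt_min (h t ht) (h' t ht)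

theorem IsGauge.mono {δ : ℝ → ℝ} {a' b' : ℝ} (h : IsGauge δ a b) (ha : a ≤ a') (hb : b' ≤ b) :
    IsGauge δ a' b' := fun t ht => h t ⟨ha.trans ht.1, ht.2.trans hb⟩

theorem HasKurzweilIntegral.exists_isFine (h : HasKurzweilIntegral G a b I) (hab : a ≤ b)
    {δ : ℝ → ℝ} (hδ : IsGauge δ a b) {ε : ℝ} (hε : 0 < ε) :
    ∃ P : TaggedPartition a b, P.IsFine δ ∧ ‖P.kurzweilSum G - I‖ < ε := by
  obtain ⟨δ', hδ', H⟩ := h ε hε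
  obtain ⟨P, hP⟩ := TaggedPartition.exists_isFine hab (hδ.min hδ')
  exact ⟨P, hP.mono fun _ => min_le_left _ _, H P (hP.mono fun _ => min_le_right _ _)⟩

theorem HasKurzweilIntegral.eq_zero_of_refl (h : HasKurzweilIntegral G a a I) : I = 0 := by
  by_contra hI
  obtain ⟨δ, -, H⟩ := h ‖I‖ (norm_pos_iff.2 hI)
  have hlt := H (TaggedPartition.refl a) (TaggedPartition.isFine_refl a δ)
  rw [TaggedPartition.kurzweilSum_refl, zero_sub, norm_neg] at hlt
  exact lt_irrefl _ hlt

theorem HasKurzweilIntegral.sub_left (hab : a ≤ b) (hbc : b ≤ c)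
    (h : HasKurzweilIntegral G a b I) (h' : HasKurzweilIntegral G a c I') :
    HasKurzweilIntegral G b c (I' - I) := by
  intro ε hε
  obtain ⟨δ, hδ, H⟩ := h' (ε / 2) (half_pos hε)
  obtain ⟨P, hP, hPI⟩ := h.exists_isFine hab (hδ.mono le_rfl hbc) (half_pos hε)
  refine ⟨δ, hδ.mono hab le_rfl, fun Q hQ => ?_⟩
  obtain ⟨R, hR, hRG⟩ := TaggedPartition.exists_isFine_kurzweilSum_add hP hQ G
  calc ‖Q.kurzweilSum G - (I' - I)‖ = ‖(R.kurzweilSum G - I') - (P.kurzweilSum G - I)‖ := by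
        rw [hRG]; congr 1; abel
    _ < ε := (norm_sub_le _ _).trans_lt (by linarith [H R hR])

theorem HasKurzweilIntegral.sub_right (hab : a ≤ b) (hbc : b ≤ c)
    (h : HasKurzweilIntegral G b c I) (h' : HasKurzweilIntegral G a c I') :
    HasKurzweilIntegral G a b (I' - I) := by
  intro ε hε
  obtain ⟨δ, hδ, H⟩ := h' (ε / 2) (half_pos hε)
  obtain ⟨P, hP, hPI⟩ := h.exists_isFine hbc (hδ.mono hab le_rfl) (half_pos hε)
  refine ⟨δ, hδ.mono le_rfl hbc, fun Q hQ => ?_⟩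
  obtain ⟨R, hR, hRG⟩ := TaggedPartition.exists_isFine_kurzweilSum_add hQ hP G
  calc ‖Q.kurzweilSum G - (I' - I)‖ = ‖(R.kurzweilSum G - I') - (P.kurzweilSum G - I)‖ := by
        rw [hRG]; congr 1; abel
    _ < ε := (norm_sub_le _ _).trans_lt (by linarith [H R hR])

/-- `F` is an indefinite Kurzweil integral of `G` on `J`. -/
def IsKurzweilPrimitiveOn (G : ℝ → ℝ → X) (J : Set ℝ) (F : ℝ → X) : Prop :=
  ∀ c d : ℝ, c ≤ d → Icc c d ⊆ J → HasKurzweilIntegral G c d (F d - F c)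

theorem IsKurzweilPrimitiveOn.mono {J J' : Set ℝ} (h : IsKurzweilPrimitiveOn G J F)
    (hJ : J' ⊆ J) : IsKurzweilPrimitiveOn G J' F :=
  fun c d hcd hJ' => h c d hcd (hJ'.trans hJ)

theorem IsKurzweilPrimitiveOn.hasOrientedKurzweilIntegral {J : Set ℝ} [J.OrdConnected]
    (h : IsKurzweilPrimitiveOn G J F) {s t : ℝ} (hs : s ∈ J) (ht : t ∈ J) :
    HasOrientedKurzweilIntegral G s t (F t - F s) :=
  ⟨fun hst => h s t hst (OrdConnected.out ‹_› hs ht), fun hts => by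
    rw [neg_sub]
    exact h t s hts.le (OrdConnected.out ‹_› ht hs)⟩

theorem isKurzweilPrimitiveOn_uIcc {s t : ℝ}
    (h : ∀ u ∈ uIcc s t, HasOrientedKurzweilIntegral G s u (F u - F s)) :
    IsKurzweilPrimitiveOn G (uIcc s t) F := by
  intro c d hcd hJ
  have hc := hJ (left_mem_Icc.2 hcd)
  have hd := hJ (right_mem_Icc.2 hcd)
  rcases le_total s t with hst | hts
  · rw [uIcc_of_le hst] at hc
    simpa only [sub_sub_sub_cancel_right] using
      ((h c (uIcc_of_le hst ▸ hc)).1 hc.1).sub_left hc.1 hcd ((h d hd).1 (hc.1.trans hcd))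
  · have backward : ∀ u ∈ uIcc s t, u ≤ s → HasKurzweilIntegral G u s (F s - F u) :=
      fun u hu hus => by
        rcases hus.eq_or_lt with rfl | hlt
        · exact (h u hu).1 le_rfl
        · simpa only [neg_sub] using (h u hu).2 hlt
    have hds : d ≤ s := (uIcc_of_ge hts ▸ hd).2
    simpa only [sub_sub_sub_cancel_left] using
      (backward d hd hds).sub_right hcd hds (backward c hc (hcd.trans hds))

/-- The Saks–Henstock lemma for a single tagged interval. -/
theorem IsKurzweilPrimitiveOn.exists_isGauge (h : IsKurzweilPrimitiveOn G (Icc a b) F)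
    (hab : a ≤ b) {ε : ℝ} (hε : 0 < ε) :
    ∃ δ, IsGauge δ a b ∧ ∀ p q τ, a ≤ p → p < q → q ≤ b → τ ∈ Icc p q →
      Icc p q ⊆ Ioo (τ - δ τ) (τ + δ τ) → ‖F q - F p - (G τ q - G τ p)‖ ≤ ε := by
  obtain ⟨δ, hδ, H⟩ := h a b hab le_rfl (ε / 3) (by linarith)
  refine ⟨δ, hδ, fun p q τ hap hpq hqb hτ hpqδ => ?_⟩
  have hpb := hpq.le.trans hqb
  have haq := hap.trans hpq.le
  obtain ⟨P, hP, hPF⟩ := (h a p hap (Icc_subset_Icc_right hpb)).exists_isFine hap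
    (hδ.mono le_rfl hpb) (show 0 < ε / 3 by linarith)
  obtain ⟨Q, hQ, hQF⟩ := (h q b hqb (Icc_subset_Icc_left haq)).exists_isFine hqb
    (hδ.mono haq le_rfl) (show 0 < ε / 3 by linarith)
  obtain ⟨R, hR, hRG⟩ := TaggedPartition.exists_isFine_kurzweilSum_add hP
    (hQ.cons hpq hτ hpqδ) G
  rw [TaggedPartition.kurzweilSum_cons] at hRG
  calc ‖F q - F p - (G τ q - G τ p)‖
      = ‖(P.kurzweilSum G - (F p - F a)) + (Q.kurzweilSum G - (F b - F q)) -
          (R.kurzweilSum G - (F b - F a))‖ := by rw [hRG]; congr 1; abel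
    _ ≤ ε := by
      linarith [H R hR, norm_add_le (P.kurzweilSum G - (F p - F a))
        (Q.kurzweilSum G - (F b - F q)), norm_sub_le ((P.kurzweilSum G - (F p - F a)) +
          (Q.kurzweilSum G - (F b - F q))) (R.kurzweilSum G - (F b - F a))]

theorem IsKurzweilPrimitiveOn.tendsto (h : IsKurzweilPrimitiveOn G (Icc a b) F) {τ : ℝ}
    (hτ : τ ∈ Icc a b) :
    Tendsto (fun u => F u - G τ u) (𝓝[Icc a b] τ) (𝓝 (F τ - G τ τ)) := by
  refine Metric.nhdsWithin_basis_ball.tendsto_iff Metric.nhds_basis_closedBall |>.2 fun ε hε => ?_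
  obtain ⟨δ, hδ, H⟩ := h.exists_isGauge (hτ.1.trans hτ.2) hε
  refine ⟨δ τ, hδ τ hτ, fun u ⟨huτ, hu⟩ => mem_closedBall_iff_norm.2 ?_⟩
  rw [Real.ball_eq_Ioo] at huτ
  have hττ : τ ∈ Ioo (τ - δ τ) (τ + δ τ) :=
    ⟨sub_lt_self _ (hδ τ hτ), lt_add_of_pos_right _ (hδ τ hτ)⟩
  rw [sub_sub_sub_comm]
  rcases lt_trichotomy u τ with hlt | rfl | hlt
  · rw [← norm_neg, neg_sub', neg_sub, neg_sub]
    exact H u τ τ hu.1 hlt hτ.2 (right_mem_Icc.2 hlt.le) (Icc_subset_Ioo huτ.1 hττ.2)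
  · simpa using hε.le
  · exact H τ u τ hτ.1 hlt hu.2 (left_mem_Icc.2 hlt.le) (Icc_subset_Ioo hττ.1 huτ.2)

theorem hasKurzweilIntegral_of_eventually_norm_sub_le {μ : ℝ → ℝ} (hμ : Monotone μ)
    (h : ∀ ε > 0, ∀ τ ∈ Icc a b, ∀ᶠ u in 𝓝[Icc a b] τ,
      ‖F u - F τ - (G τ u - G τ τ)‖ ≤ ε * |μ u - μ τ|) :
    HasKurzweilIntegral G a b (F b - F a) := by
  intro ε hε
  obtain ⟨η, hη, hηε⟩ := exists_pos_mul_lt hε (μ b - μ a)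
  have hδ : ∀ τ ∈ Icc a b, ∃ δ > 0, ∀ u ∈ Icc a b, u ∈ Ioo (τ - δ) (τ + δ) →
      ‖F u - F τ - (G τ u - G τ τ)‖ ≤ η * |μ u - μ τ| := fun τ hτ => by
    obtain ⟨δ, hδ, H⟩ := Metric.mem_nhdsWithin_iff.1 (h η hη τ hτ)
    exact ⟨δ, hδ, fun u hu huδ => H ⟨by rwa [Real.ball_eq_Ioo], hu⟩⟩
  choose! δ hδ H using hδ
  refine ⟨δ, hδ, fun P hP => ?_⟩
  suffices hj : ∀ j < P.ν, ‖G (P.tag j) (P.pt (j + 1)) - G (P.tag j) (P.pt j) -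
      (F (P.pt (j + 1)) - F (P.pt j))‖ ≤ η * μ (P.pt (j + 1)) - η * μ (P.pt j) from
    (P.norm_kurzweilSum_sub_le (m := fun t => η * μ t) hj).trans_lt (by linarith)
  intro j hj
  have hlt := (P.pt_lt j hj).le
  obtain ⟨hpτ, hτq⟩ := P.tag_mem j hj
  have hp := H _ (P.tag_mem_Icc hj) _ (P.pt_mem_Icc hj.le) (hP j hj ⟨le_rfl, hlt⟩)
  have hq := H _ (P.tag_mem_Icc hj) _ (P.pt_mem_Icc (j := j + 1) hj) (hP j hj ⟨hlt, le_rfl⟩)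
  rw [abs_of_nonpos (sub_nonpos.2 (hμ hpτ))] at hp
  rw [abs_of_nonneg (sub_nonneg.2 (hμ hτq))] at hq
  generalize P.pt j = p, P.pt (j + 1) = q, P.tag j = τ at *
  calc ‖G τ q - G τ p - (F q - F p)‖
      = ‖(F p - F τ - (G τ p - G τ τ)) - (F q - F τ - (G τ q - G τ τ))‖ := by congr 1; abel
    _ ≤ η * -(μ p - μ τ) + η * (μ q - μ τ) := norm_sub_le_of_le hp hq
    _ = η * μ q - η * μ p := by ring

end Integral

/-! ### Approximate solutions -/

section LinearEquation

variable {R M : Type*} [NormedRing R] [NormedAddCommGroup M] [Module R M]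

section ApproximateSolutions

/-- `x` solves `dx = D[A(t)x]` on `J` up to an error `ε |μ u - μ τ|` in the increment from `τ` to
every nearby `u`. Here `M` is any module over the normed ring `R` of coefficients: for
`R = L(E)` this covers both the vector equation, `M = E`, and the matrix equation, `M = L(E)`. -/
def IsApproxSolutionOn (A : ℝ → R) (μ : ℝ → ℝ) (ε : ℝ) (J : Set ℝ) (x : ℝ → M) : Prop :=
  ∀ τ ∈ J, ∀ᶠ u in 𝓝[J] τ, ‖x u - x τ - (A u - A τ) • x τ‖ ≤ ε * |μ u - μ τ|

/-- `x` solves `dx = D[A(t)x]` on `J` up to `o(μ)` at every point. For a function `A` whose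
increments are bounded by those of `μ`, these are the solutions in the sense of the Kurzweil
integral. -/
def IsLocalSolutionOn (A : ℝ → R) (μ : ℝ → ℝ) (J : Set ℝ) (x : ℝ → M) : Prop :=
  ∀ ε > 0, IsApproxSolutionOn A μ ε J x

/-- The increments of `A` on `J` are bounded by those of the nondecreasing function `μ`. -/
structure HasIncrementBound {X : Type*} [NormedAddCommGroup X] (A : ℝ → X) (μ : ℝ → ℝ)
    (J : Set ℝ) : Prop where
  monotone : Monotone μ
  norm_sub_le : ∀ u ∈ J, ∀ v ∈ J, ‖A v - A u‖ ≤ |μ v - μ u|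

theorem HasIncrementBound.mono {X : Type*} [NormedAddCommGroup X] {A : ℝ → X} {μ : ℝ → ℝ}
    {J J' : Set ℝ} (h : HasIncrementBound A μ J) (hJ : J' ⊆ J) : HasIncrementBound A μ J' :=
  ⟨h.monotone, fun u hu v hv => h.norm_sub_le u (hJ hu) v (hJ hv)⟩

variable {A : ℝ → R} {μ : ℝ → ℝ} {ε ε' : ℝ} {J J' : Set ℝ} {x y : ℝ → M} {a b s t : ℝ}

theorem abs_sub_eq_add_of_monotone (hμ : Monotone μ) {u v w : ℝ} (huv : u ≤ v) (hvw : v ≤ w) :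
    |μ w - μ u| = |μ w - μ v| + |μ v - μ u| := by
  rw [abs_of_nonneg (sub_nonneg.2 (hμ huv)), abs_of_nonneg (sub_nonneg.2 (hμ hvw)),
    abs_of_nonneg (sub_nonneg.2 (hμ (huv.trans hvw))), sub_add_sub_cancel]

theorem IsApproxSolutionOn.mono (h : IsApproxSolutionOn A μ ε J x) (hJ : J' ⊆ J) :
    IsApproxSolutionOn A μ ε J' x :=
  fun τ hτ => nhdsWithin_mono τ hJ (h τ (hJ hτ))

theorem IsLocalSolutionOn.mono (h : IsLocalSolutionOn A μ J x) (hJ : J' ⊆ J) :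
    IsLocalSolutionOn A μ J' x := fun ε hε => (h ε hε).mono hJ

theorem IsApproxSolutionOn.of_le (h : IsApproxSolutionOn A μ ε J x) (hε : ε ≤ ε') :
    IsApproxSolutionOn A μ ε' J x := fun τ hτ =>
  (h τ hτ).mono fun _ hu => hu.trans (mul_le_mul_of_nonneg_right hε (abs_nonneg _))

theorem IsApproxSolutionOn.congr (h : IsApproxSolutionOn A μ ε J x) (hxy : EqOn x y J) :
    IsApproxSolutionOn A μ ε J y := fun τ hτ => by
  filter_upwards [h τ hτ, self_mem_nhdsWithin] with u hu huJ
  rwa [← hxy huJ, ← hxy hτ]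

theorem IsApproxSolutionOn.sub (hx : IsApproxSolutionOn A μ ε J x)
    (hy : IsApproxSolutionOn A μ ε' J y) :
    IsApproxSolutionOn A μ (ε + ε') J (fun t => x t - y t) := fun τ hτ => by
  filter_upwards [hx τ hτ, hy τ hτ] with u hxu hyu
  calc ‖x u - y u - (x τ - y τ) - (A u - A τ) • (x τ - y τ)‖
      = ‖(x u - x τ - (A u - A τ) • x τ) - (y u - y τ - (A u - A τ) • y τ)‖ := by
        rw [smul_sub]; congr 1; abel
    _ ≤ (ε + ε') * |μ u - μ τ| := (norm_sub_le_of_le hxu hyu).trans_eq (add_mul _ _ _).symm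

theorem IsApproxSolutionOn.union (hJ : IsClosed J) (hJ' : IsClosed J')
    (h : IsApproxSolutionOn A μ ε J x) (h' : IsApproxSolutionOn A μ ε J' x) :
    IsApproxSolutionOn A μ ε (J ∪ J') x := by
  have local_of_mem : ∀ {K : Set ℝ}, IsClosed K → IsApproxSolutionOn A μ ε K x → ∀ τ,
      ∀ᶠ u in 𝓝[K] τ, ‖x u - x τ - (A u - A τ) • x τ‖ ≤ ε * |μ u - μ τ| := fun {K} hK h τ => by
    by_cases hτ : τ ∈ K
    · exact h τ hτ
    · rw [notMem_closure_iff_nhdsWithin_eq_bot.1 (hK.closure_eq.symm ▸ hτ)]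
      exact eventually_bot
  intro τ _
  rw [nhdsWithin_union]
  exact eventually_sup.2 ⟨local_of_mem hJ h τ, local_of_mem hJ' h' τ⟩

theorem IsApproxSolutionOn.of_forall_uIcc [J.OrdConnected]
    (h : ∀ t ∈ J, IsApproxSolutionOn A μ ε (uIcc s t) x) : IsApproxSolutionOn A μ ε J x := by
  refine fun τ hτ => eventually_nhdsWithin_of_forall_isSide hτ (by simp) fun l hl hJ => ?_
  have := hl.neBot
  obtain ⟨p, hpl, hp⟩ := (hl.eventually_uIcc_mem.and hJ).exists
  have hτp : IsApproxSolutionOn A μ ε (uIcc τ p) x :=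
    (((h τ hτ).union isCompact_uIcc.isClosed isCompact_uIcc.isClosed (h p hp))).mono
      (uIcc_comm s τ ▸ uIcc_subset_uIcc_union_uIcc)
  exact hl.le_nhdsWithin hpl (hτp τ left_mem_uIcc)

theorem IsApproxSolutionOn.exists_extend {u v : ℝ} (hx : IsApproxSolutionOn A μ ε (uIcc s u) x)
    (hy : IsApproxSolutionOn A μ ε (uIcc u v) y) (hxy : y u = x u) (hu : u ∈ uIcc s v) :
    ∃ z, IsApproxSolutionOn A μ ε (uIcc s v) z ∧ z s = x s := by
  classical
  let z : ℝ → M := (uIcc s u).piecewise x y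
  have hzx : EqOn z x (uIcc s u) := piecewise_eqOn _ _ _
  have hzy : EqOn z y (uIcc u v) := fun t ht => by
    by_cases hts : t ∈ uIcc s u
    · have htu : t = u := by
        rw [mem_uIcc] at hu ht hts
        grind
      rw [htu, hzx right_mem_uIcc, hxy]
    · exact piecewise_eq_of_notMem _ _ _ hts
  have hz := (hx.congr hzx.symm).union isCompact_uIcc.isClosed isCompact_uIcc.isClosed
    (hy.congr hzy.symm)
  exact ⟨z, hz.mono uIcc_subset_uIcc_union_uIcc, hzx left_mem_uIcc⟩

theorem isApproxSolutionOn_singleton (t : ℝ) (x : ℝ → M) : IsApproxSolutionOn A μ ε {t} x := by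
  rintro τ rfl
  rw [nhdsWithin_singleton, eventually_pure]
  simp

variable [IsBoundedSMul R M]

theorem IsApproxSolutionOn.smul_const {Φ : ℝ → R} (h : IsApproxSolutionOn A μ ε J Φ) (y : M) :
    IsApproxSolutionOn A μ (ε * ‖y‖) J (fun t => Φ t • y) := fun τ hτ => by
  filter_upwards [h τ hτ] with u hu
  calc ‖Φ u • y - Φ τ • y - (A u - A τ) • Φ τ • y‖
      = ‖(Φ u - Φ τ - (A u - A τ) • Φ τ) • y‖ := by
        rw [sub_smul _ ((A u - A τ) • Φ τ), sub_smul (Φ u), smul_assoc]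
    _ ≤ ε * |μ u - μ τ| * ‖y‖ := (norm_smul_le _ _).trans (by gcongr)
    _ = ε * ‖y‖ * |μ u - μ τ| := by ring

theorem IsLocalSolutionOn.smul_const {Φ : ℝ → R} (h : IsLocalSolutionOn A μ J Φ) (y : M) :
    IsLocalSolutionOn A μ J fun t => Φ t • y := fun ε hε => by
  obtain ⟨η, hη, hηε⟩ := exists_pos_mul_lt hε ‖y‖
  exact ((h η hη).smul_const y).of_le (mul_comm ‖y‖ η ▸ hηε.le)

theorem IsApproxSolutionOn.norm_sub_le {S : ℝ} [J.OrdConnected] (hA : HasIncrementBound A μ J)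
    (hx : IsApproxSolutionOn A μ ε J x) (hS : ∀ t ∈ J, ‖x t‖ ≤ S) {u v : ℝ} (hu : u ∈ J)
    (hv : v ∈ J) : ‖x v - x u‖ ≤ (S + ε) * |μ v - μ u| := by
  wlog huv : u ≤ v generalizing u v
  · rw [norm_sub_rev, abs_sub_comm]
    exact this hv hu (le_of_not_ge huv)
  have hloc : ∀ τ ∈ J, ∀ᶠ w in 𝓝[J] τ, ‖x w - x τ‖ ≤ (S + ε) * |μ w - μ τ| := fun τ hτ => by
    filter_upwards [hx τ hτ, self_mem_nhdsWithin] with w hw hwJ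
    calc ‖x w - x τ‖ ≤ ‖(A w - A τ) • x τ‖ + ‖x w - x τ - (A w - A τ) • x τ‖ :=
          norm_le_norm_add_norm_sub' _ _
      _ ≤ |μ w - μ τ| * S + ε * |μ w - μ τ| := by
        refine add_le_add ((norm_smul_le _ _).trans ?_) hw
        exact mul_le_mul (hA.norm_sub_le τ hτ w hwJ) (hS τ hτ) (norm_nonneg _) (abs_nonneg _)
      _ = (S + ε) * |μ w - μ τ| := by ring
  have hJ : Icc u v ⊆ J := Set.OrdConnected.out ‹_› hu hv
  refine interval_induction (P := fun u v => ‖x v - x u‖ ≤ (S + ε) * |μ v - μ u|) huv (by simp)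
    (fun p q r _ hpq hqr _ hxq hxr => ?_) (fun τ hτ => ?_) fun τ hτ => ?_
  · rw [abs_sub_eq_add_of_monotone hA.monotone hpq hqr, mul_add]
    exact (norm_sub_le_norm_sub_add_norm_sub (x r) (x q) (x p)).trans (add_le_add hxr hxq)
  · filter_upwards [(isSide_left τ).le_nhdsWithin (mem_of_superset (Icc_mem_nhdsLT_of_mem hτ) hJ)
      (hloc τ (hJ (Ioc_subset_Icc_self hτ)))] with w hw
    rwa [norm_sub_rev, abs_sub_comm]
  · exact (isSide_right τ).le_nhdsWithin (mem_of_superset (Icc_mem_nhdsGT_of_mem hτ) hJ)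
      (hloc τ (hJ (Ico_subset_Icc_self hτ)))

end ApproximateSolutions

/-! ### Growth bounds and uniqueness -/

section Growth

/-- The jumps of `A` inside `J` are invertible: at every `t ∈ J` and on either side of `t` that
meets `J`, the one-sided limit `B` of `A` exists and `1 + (B - A t)` is a unit. -/
def HasInvertibleJumps (A : ℝ → R) (J : Set ℝ) : Prop :=
  ∀ t ∈ J, ∀ l, IsSide l t → J ∈ l → ∃ B, Tendsto A l (𝓝 B) ∧ IsUnit (1 + (B - A t))

theorem HasInvertibleJumps.mono {A : ℝ → R} {J J' : Set ℝ} (h : HasInvertibleJumps A J)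
    (hJ : J' ⊆ J) : HasInvertibleJumps A J' :=
  fun t ht l hl hJ' => h t (hJ ht) l hl (mem_of_superset hJ' hJ)

/-- Approximate solutions between points of `J`, in either direction of time, grow at most by the
factor `C`, up to their error `ε`. -/
structure IsGrowthBound (M : Type*) [NormedAddCommGroup M] [Module R M] (A : ℝ → R) (μ : ℝ → ℝ)
    (C : ℝ) (J : Set ℝ) : Prop where
  nonneg : 0 ≤ C
  norm_le : ∀ p ∈ J, ∀ q ∈ J, ∀ ε ≥ 0, ∀ z : ℝ → M, IsApproxSolutionOn A μ ε (uIcc p q) z →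
    ‖z q‖ ≤ C * (‖z p‖ + ε)

variable {A : ℝ → R} {μ : ℝ → ℝ} {ε : ℝ} {J : Set ℝ} {x y z : ℝ → M} {a b p q s t : ℝ}
  {l : Filter ℝ}

theorem IsGrowthBound.union {C C' : ℝ} {J' : Set ℝ} (h : IsGrowthBound M A μ C J)
    (h' : IsGrowthBound M A μ C' J') (hb : b ∈ J) (hb' : b ∈ J')
    (hJ : ∀ p ∈ J, ∀ q ∈ J', b ∈ uIcc p q) :
    IsGrowthBound M A μ ((C + 1) * (C' + 1)) (J ∪ J') := by
  have hC := h.nonneg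
  have hC' := h'.nonneg
  refine ⟨by positivity, fun p hp q hq ε hε z hz => ?_⟩
  have hzp : 0 ≤ ‖z p‖ + ε := by positivity
  have hCz : 0 ≤ C * ‖z p‖ := by positivity
  have hCz' : 0 ≤ C' * ‖z p‖ := by positivity
  have hCC' : 0 ≤ C * C' * (‖z p‖ + ε) := by positivity
  rcases hp with hp | hp <;> rcases hq with hq | hq
  · nlinarith [h.norm_le p hp q hq ε hε z hz]
  · have hbpq := hJ p hp q hq
    have hzb := h.norm_le p hp b hb ε hε z (hz.mono (uIcc_subset_uIcc_left hbpq))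
    have hzq := h'.norm_le b hb' q hq ε hε z (hz.mono (uIcc_subset_uIcc_right hbpq))
    nlinarith [mul_le_mul_of_nonneg_left hzb hC']
  · have hbpq := uIcc_comm q p ▸ hJ q hq p hp
    have hzb := h'.norm_le p hp b hb' ε hε z (hz.mono (uIcc_subset_uIcc_left hbpq))
    have hzq := h.norm_le b hb q hq ε hε z (hz.mono (uIcc_subset_uIcc_right hbpq))
    nlinarith [mul_le_mul_of_nonneg_left hzb hC]
  · nlinarith [h'.norm_le p hp q hq ε hε z hz]

theorem IsGrowthBound.uIcc_of_diff_singleton {C K : ℝ}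
    (h : IsGrowthBound M A μ K (uIcc s t \ {s})) (hC : 0 ≤ C)
    (hnear : ∀ q ∈ uIcc s t \ {s}, ∀ ε ≥ 0, ∀ z : ℝ → M, IsApproxSolutionOn A μ ε (uIcc s q) z →
      ∃ r ∈ uIcc s q \ {s}, ‖z r‖ ≤ C * (‖z s‖ + ε) ∧ ‖z s‖ ≤ C * (‖z r‖ + ε)) :
    IsGrowthBound M A μ ((K + 1) * (C + 1)) (uIcc s t) := by
  have hK := h.nonneg
  refine ⟨by positivity, fun p hp q hq ε hε z hz => ?_⟩
  have hCz : 0 ≤ C * (‖z p‖ + ε) := by positivity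
  have hKz : 0 ≤ K * (‖z p‖ + ε) := by positivity
  have hKCz : 0 ≤ K * C * (‖z p‖ + ε) := by positivity
  by_cases hps : p = s <;> by_cases hqs : q = s
  · subst hps hqs
    nlinarith
  · subst hps
    obtain ⟨r, ⟨hr, hrs⟩, hzr, -⟩ := hnear q ⟨hq, hqs⟩ ε hε z hz
    have hzq := h.norm_le r ⟨uIcc_subset_uIcc_left hq hr, hrs⟩ q ⟨hq, hqs⟩ ε hε z
      (hz.mono (uIcc_subset_uIcc_right hr))
    nlinarith [mul_le_mul_of_nonneg_left hzr hK, norm_nonneg (z p)]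
  · subst hqs
    rw [uIcc_comm] at hz
    obtain ⟨r, ⟨hr, hrs⟩, -, hzr⟩ := hnear p ⟨hp, hps⟩ ε hε z hz
    have hzp := h.norm_le p ⟨hp, hps⟩ r ⟨uIcc_subset_uIcc_left hp hr, hrs⟩ ε hε z
      (hz.mono (uIcc_comm p r ▸ uIcc_subset_uIcc_right hr))
    nlinarith [mul_le_mul_of_nonneg_left hzp hC, norm_nonneg (z p)]
  · nlinarith [h.norm_le p ⟨hp, hps⟩ q ⟨hq, hqs⟩ ε hε z hz, norm_nonneg (z p)]

theorem isGrowthBound_singleton (t : ℝ) : IsGrowthBound M A μ 1 {t} := by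
  refine ⟨zero_le_one, ?_⟩
  rintro p rfl q rfl ε hε z -
  linarith

theorem IsGrowthBound.norm_sub_le {C ε' : ℝ} (h : IsGrowthBound M A μ C J) (hs : s ∈ J)
    (ht : t ∈ J) (hε : 0 ≤ ε) (hε' : 0 ≤ ε') (hx : IsApproxSolutionOn A μ ε (uIcc s t) x)
    (hy : IsApproxSolutionOn A μ ε' (uIcc s t) y) (hxy : x s = y s) :
    ‖x t - y t‖ ≤ C * (ε + ε') :=
  (h.norm_le s hs t ht _ (add_nonneg hε hε') _ (hx.sub hy)).trans_eq (by simp [hxy])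

variable [IsBoundedSMul R M]

theorem norm_add_le_exp_mul_of_norm_sub_smul_le {α : R} {v w : M} {Δ : ℝ} (hΔ : Δ ≤ 1 / 2)
    (hα : ‖α‖ ≤ Δ) (hε : 0 ≤ ε) (h : ‖w - v - α • v‖ ≤ ε * Δ) :
    ‖w‖ + ε ≤ Real.exp (2 * Δ) * (‖v‖ + ε) ∧ ‖v‖ + ε ≤ Real.exp (2 * Δ) * (‖w‖ + ε) := by
  have hΔ₀ : 0 ≤ Δ := (norm_nonneg α).trans hα
  have hwv : ‖w - v‖ ≤ Δ * (‖v‖ + ε) := calc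
    ‖w - v‖ ≤ ‖α • v‖ + ‖w - v - α • v‖ := norm_le_norm_add_norm_sub' _ _
    _ ≤ Δ * ‖v‖ + ε * Δ := add_le_add ((norm_smul_le _ _).trans (by gcongr)) h
    _ = Δ * (‖v‖ + ε) := by ring
  have hexp : 1 + 2 * Δ ≤ Real.exp (2 * Δ) := by linarith [Real.add_one_le_exp (2 * Δ)]
  have hw : ‖w‖ + ε ≤ (1 + Δ) * (‖v‖ + ε) := by
    linarith [norm_le_norm_add_norm_sub' w v]
  have hv : (1 - Δ) * (‖v‖ + ε) ≤ ‖w‖ + ε := by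
    linarith [norm_le_norm_add_norm_sub w v]
  constructor
  · refine hw.trans ?_
    gcongr
    linarith
  · calc ‖v‖ + ε ≤ (1 + 2 * Δ) * ((1 - Δ) * (‖v‖ + ε)) := by
          nlinarith [mul_nonneg (mul_nonneg hΔ₀ (sub_nonneg.2 hΔ))
            (add_nonneg (norm_nonneg v) hε)]
      _ ≤ (1 + 2 * Δ) * (‖w‖ + ε) := by gcongr
      _ ≤ Real.exp (2 * Δ) * (‖w‖ + ε) := by gcongr

theorem IsApproxSolutionOn.norm_add_le_exp_mul (hab : a ≤ b)
    (hA : HasIncrementBound A μ (Icc a b)) (hz : IsApproxSolutionOn A μ ε (Icc a b) z)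
    (hε : 0 ≤ ε) (hμ : |μ b - μ a| ≤ 1 / 2) :
    ‖z b‖ + ε ≤ Real.exp (2 * |μ b - μ a|) * (‖z a‖ + ε) ∧
      ‖z a‖ + ε ≤ Real.exp (2 * |μ b - μ a|) * (‖z b‖ + ε) := by
  have hμab : ∀ u ∈ Icc a b, ∀ v ∈ Icc a b, |μ u - μ v| ≤ 1 / 2 := fun u hu v hv => by
    rw [abs_of_nonneg (sub_nonneg.2 (hA.monotone hab))] at hμ
    exact (abs_sub_le_of_le_of_le (hA.monotone hu.1) (hA.monotone hu.2) (hA.monotone hv.1)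
      (hA.monotone hv.2)).trans hμ
  have hloc : ∀ t ∈ Icc a b, ∀ᶠ u in 𝓝[Icc a b] t,
      ‖z u‖ + ε ≤ Real.exp (2 * |μ u - μ t|) * (‖z t‖ + ε) ∧
        ‖z t‖ + ε ≤ Real.exp (2 * |μ u - μ t|) * (‖z u‖ + ε) := fun t ht => by
    filter_upwards [hz t ht, self_mem_nhdsWithin] with u hu hub
    exact norm_add_le_exp_mul_of_norm_sub_smul_le (hμab u hub t ht) (hA.norm_sub_le t ht u hub)
      hε hu
  refine interval_induction (P := fun u v =>
    ‖z v‖ + ε ≤ Real.exp (2 * |μ v - μ u|) * (‖z u‖ + ε) ∧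
      ‖z u‖ + ε ≤ Real.exp (2 * |μ v - μ u|) * (‖z v‖ + ε)) hab (by simp)
    (fun u v w _ huv hvw _ hu hw => ?_) (fun t ht => ?_) fun t ht => ?_
  · have hexp : Real.exp (2 * |μ w - μ u|) =
        Real.exp (2 * |μ w - μ v|) * Real.exp (2 * |μ v - μ u|) := by
      rw [abs_sub_eq_add_of_monotone hA.monotone huv hvw, mul_add, Real.exp_add]
    constructor
    · rw [hexp, mul_assoc]
      exact hw.1.trans (mul_le_mul_of_nonneg_left hu.1 (Real.exp_nonneg _))
    · rw [hexp, mul_comm (Real.exp _), mul_assoc]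
      exact hu.2.trans (mul_le_mul_of_nonneg_left hw.2 (Real.exp_nonneg _))
  · filter_upwards [(isSide_left t).le_nhdsWithin (Icc_mem_nhdsLT_of_mem ht)
      (hloc t (Ioc_subset_Icc_self ht))] with u hu
    rw [abs_sub_comm]
    exact hu.symm
  · exact (isSide_right t).le_nhdsWithin (Icc_mem_nhdsGT_of_mem ht)
      (hloc t (Ico_subset_Icc_self ht))

theorem IsApproxSolutionOn.norm_le_three_mul (hA : HasIncrementBound A μ (uIcc p q))
    (hz : IsApproxSolutionOn A μ ε (uIcc p q) z) (hε : 0 ≤ ε) (hμ : |μ q - μ p| ≤ 1 / 2) :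
    ‖z q‖ ≤ 3 * (‖z p‖ + ε) := by
  have hexp : Real.exp (2 * |μ q - μ p|) ≤ 3 :=
    (Real.exp_le_exp.2 (by linarith)).trans Real.exp_one_lt_three.le
  have hle : ‖z q‖ + ε ≤ Real.exp (2 * |μ q - μ p|) * (‖z p‖ + ε) := by
    rcases le_total p q with hpq | hpq
    · rw [uIcc_of_le hpq] at hA hz
      exact (hz.norm_add_le_exp_mul hpq hA hε hμ).1
    · rw [uIcc_of_ge hpq] at hA hz
      rw [abs_sub_comm] at hμ ⊢
      exact (hz.norm_add_le_exp_mul hpq hA hε hμ).2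
  have : Real.exp (2 * |μ q - μ p|) * (‖z p‖ + ε) ≤ 3 * (‖z p‖ + ε) := by gcongr
  linarith

theorem exists_eventually_inverse_norm_le [CompleteSpace R] {f : ℝ → R} {U : R}
    (hf : Tendsto f l (𝓝 U)) (hU : IsUnit U) :
    ∃ K ≥ 0, ∀ᶠ u in l, ∃ S, f u * S = 1 ∧ S * f u = 1 ∧ ‖S‖ ≤ K := by
  obtain ⟨V, rfl⟩ := hU
  have hinv : Tendsto (fun u => Ring.inverse (f u)) l (𝓝 (Ring.inverse (V : R))) :=
    (NormedRing.inverse_continuousAt V).tendsto.comp hf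
  refine ⟨‖Ring.inverse (V : R)‖ + 1, by positivity, ?_⟩
  filter_upwards [hf (Units.isOpen.mem_nhds V.isUnit),
    hinv.norm.eventually (gt_mem_nhds (lt_add_one _))] with u hu hlt
  exact ⟨Ring.inverse (f u), Ring.mul_inverse_cancel _ hu, Ring.inverse_mul_cancel _ hu, hlt.le⟩

theorem exists_eventually_norm_le_of_norm_sub_smul_le [CompleteSpace R]
    (hA : HasIncrementBound A μ J) (hD : HasInvertibleJumps A J) (ht : t ∈ J) (hl : IsSide l t)
    (hJ : J ∈ l) :
    ∃ C ≥ 0, ∀ᶠ u in l, ∀ ε ≥ 0, ∀ v w : M, ‖w - v - (A u - A t) • v‖ ≤ ε * |μ u - μ t| →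
      ‖w‖ ≤ C * (‖v‖ + ε) ∧ ‖v‖ ≤ C * (‖w‖ + ε) := by
  obtain ⟨m, hm⟩ := hl.exists_tendsto hA.monotone
  obtain ⟨B, hB, hU⟩ := hD t ht l hl hJ
  obtain ⟨K, hK, hinv⟩ := exists_eventually_inverse_norm_le
    (tendsto_const_nhds.add (hB.sub_const (A t))) hU
  obtain ⟨c, hc, hμc⟩ : ∃ c ≥ 0, ∀ᶠ u in l, |μ u - μ t| ≤ c :=
    ⟨|m - μ t| + 1, by positivity, (hm.sub_const (μ t)).abs.eventually_le_const (lt_add_one _)⟩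
  refine ⟨(1 + K) * (1 + c), by positivity, ?_⟩
  filter_upwards [hinv, hμc, hJ] with u ⟨S, _, hS, hSK⟩ huc huJ ε hε v w h
  have hα : ‖A u - A t‖ ≤ c := (hA.norm_sub_le t ht u huJ).trans huc
  have hεc : ‖w - v - (A u - A t) • v‖ ≤ ε * c := h.trans (by gcongr)
  constructor
  · calc ‖w‖ ≤ ‖v‖ + ‖(A u - A t) • v‖ + ‖w - v - (A u - A t) • v‖ := by
          rw [sub_sub]
          exact (norm_le_norm_add_norm_sub' w _).trans (by gcongr; exact norm_add_le _ _)
      _ ≤ ‖v‖ + c * ‖v‖ + ε * c := by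
          gcongr
          exact (norm_smul_le _ _).trans (by gcongr)
      _ ≤ (1 + c) * (‖v‖ + ε) := by linarith
      _ ≤ (1 + K) * (1 + c) * (‖v‖ + ε) := by
          gcongr
          exact le_mul_of_one_le_left (by positivity) (by linarith)
  · have hv : v = S • (w - (w - v - (A u - A t) • v)) := by
      rw [sub_sub, sub_sub_cancel, ← one_smul R v, smul_smul, mul_one, ← add_smul, smul_smul, hS]
    calc ‖v‖ ≤ K * (‖w‖ + ε * c) := by
          conv_lhs => rw [hv]
          exact (norm_smul_le _ _).trans (mul_le_mul hSK
            ((norm_sub_le _ _).trans (by gcongr)) (norm_nonneg _) hK)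
      _ ≤ (1 + K) * ((1 + c) * (‖w‖ + ε)) := by
          gcongr
          · linarith
          · nlinarith [norm_nonneg w]
      _ = (1 + K) * (1 + c) * (‖w‖ + ε) := (mul_assoc _ _ _).symm

/-- Away from `t` the function `μ` hardly varies, so all the growth comes from the jump at `t`. -/
theorem exists_eventually_isGrowthBound_uIcc [CompleteSpace R] (hA : HasIncrementBound A μ J)
    (hD : HasInvertibleJumps A J) (ht : t ∈ J) (hl : IsSide l t) (hJ : J ∈ l) :
    ∃ C, ∀ᶠ v in l, uIcc t v ⊆ J → IsGrowthBound M A μ C (uIcc t v) := by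
  have := hl.neBot
  obtain ⟨m, hm⟩ := hl.exists_tendsto hA.monotone
  obtain ⟨C, hC, hjump⟩ := exists_eventually_norm_le_of_norm_sub_smul_le (M := M) hA hD ht hl hJ
  have hclose : ∀ᶠ u in l, |μ u - m| < 1 / 4 :=
    (tendsto_order.1 (tendsto_iff_norm_sub_tendsto_zero.1 hm)).2 _ (by norm_num)
  refine ⟨(3 + 1) * (C + 1), ?_⟩
  filter_upwards [hl.eventually_forall_uIcc (hclose.and hl.eventually_uIcc_mem)] with v hv hvJ
  have away : IsGrowthBound M A μ 3 (uIcc t v \ {t}) :=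
    ⟨by norm_num, fun p ⟨hp, hpt⟩ q ⟨hq, hqt⟩ ε hε z hz => hz.norm_le_three_mul
      (hA.mono ((uIcc_subset_uIcc hp hq).trans hvJ)) hε (by
        have hp := abs_lt.1 (hv p hp hpt).1
        have hq := abs_lt.1 (hv q hq hqt).1
        exact abs_le.2 ⟨by linarith, by linarith⟩)⟩
  refine away.uIcc_of_diff_singleton hC fun q ⟨hq, hqt⟩ ε hε z hz => ?_
  have hmem := (hv q hq hqt).2
  have hzt := (hz t left_mem_uIcc).filter_mono (hl.le_nhdsWithin hmem)
  obtain ⟨r, hjr, hzr, hr, hrt⟩ := (hjump.and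
    (hzt.and (Filter.Eventually.and hmem hl.eventually_ne))).exists
  exact ⟨r, ⟨hr, hrt⟩, hjr ε hε _ _ hzr⟩

theorem exists_isGrowthBound [CompleteSpace R] (hA : HasIncrementBound A μ (uIcc s t))
    (hD : HasInvertibleJumps A (uIcc s t)) : ∃ C, IsGrowthBound M A μ C (uIcc s t) := by
  refine interval_induction (P := fun u v => ∃ C, IsGrowthBound M A μ C (Icc u v))
    (inf_le_sup : s ⊓ t ≤ s ⊔ t) ⟨1, by rw [Icc_self]; exact isGrowthBound_singleton _⟩
    (fun u v w _ huv hvw _ ⟨C, hC⟩ ⟨C', hC'⟩ => ?_) (fun τ hτ => ?_) fun τ hτ => ?_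
  · refine ⟨_, Icc_union_Icc_eq_Icc huv hvw ▸ hC.union hC' (right_mem_Icc.2 huv)
      (left_mem_Icc.2 hvw) fun p hp q hq => ?_⟩
    exact Icc_subset_uIcc ⟨hp.2, hq.1⟩
  · obtain ⟨C, hC⟩ := exists_eventually_isGrowthBound_uIcc (M := M) hA hD
      (Ioc_subset_Icc_self hτ) (isSide_left τ) (Icc_mem_nhdsLT_of_mem hτ)
    filter_upwards [hC, Ico_mem_nhdsLT hτ.1] with u hu huτ
    rw [uIcc_of_ge huτ.2.le] at hu
    exact ⟨C, hu (Icc_subset_Icc huτ.1 hτ.2)⟩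
  · obtain ⟨C, hC⟩ := exists_eventually_isGrowthBound_uIcc (M := M) hA hD
      (Ico_subset_Icc_self hτ) (isSide_right τ) (Icc_mem_nhdsGT_of_mem hτ)
    filter_upwards [hC, Ioc_mem_nhdsGT hτ.2] with u hu huτ
    rw [uIcc_of_le huτ.1.le] at hu
    exact ⟨C, hu (Icc_subset_Icc hτ.1 huτ.2)⟩

theorem IsLocalSolutionOn.eqOn [CompleteSpace R] [J.OrdConnected] (hA : HasIncrementBound A μ J)
    (hD : HasInvertibleJumps A J) (hx : IsLocalSolutionOn A μ J x)
    (hy : IsLocalSolutionOn A μ J y) (hs : s ∈ J) (hxy : x s = y s) : EqOn x y J := by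
  intro t ht
  have hst : uIcc s t ⊆ J := OrdConnected.uIcc_subset ‹_› hs ht
  obtain ⟨C, hC⟩ := exists_isGrowthBound (M := M) (hA.mono hst) (hD.mono hst)
  have hbound : ∀ ε > 0, ‖x t - y t‖ ≤ C * (ε + ε) := fun ε hε =>
    hC.norm_sub_le left_mem_uIcc right_mem_uIcc hε.le hε.le ((hx ε hε).mono hst)
      ((hy ε hε).mono hst) hxy
  have hlim : Tendsto (fun ε : ℝ => C * (ε + ε)) (𝓝[>] 0) (𝓝 0) := by
    refine tendsto_nhdsWithin_of_tendsto_nhds (Continuous.tendsto' ?_ _ _ (by simp))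
    fun_prop
  exact sub_eq_zero.1 (norm_le_zero_iff.1 (ge_of_tendsto hlim
    (eventually_mem_nhdsWithin.mono hbound)))

end Growth

/-! ### Existence -/

section Existence

variable [IsBoundedSMul R M] {A : ℝ → R} {μ : ℝ → ℝ} {ε : ℝ} {J : Set ℝ} {x : ℝ → M} {s t : ℝ}
  {l : Filter ℝ} {B : R}

/-- The explicit approximate propagator from `t` to points `u` on one side of `t`, where `B` is the
limit of `A` on that side: first the jump at `t`, then one explicit Euler step. -/
noncomputable def jumpPropagator (A : ℝ → R) (B : R) (t u : ℝ) : R :=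
  if u = t then 1 else (1 + (A u - B)) * (1 + (B - A t))

theorem isApproxSolutionOn_jumpPropagator {η : ℝ} (hη : 0 ≤ η) (hA : HasIncrementBound A μ J)
    (hAB : ∀ u ∈ J, u ≠ t → ‖A u - B‖ ≤ η ∧ ‖B - A t‖ ≤ |μ u - μ t|) :
    IsApproxSolutionOn A μ (η * (1 + ‖1 + (B - A t)‖)) J (jumpPropagator A B t) := by
  intro τ hτ
  rcases eq_or_ne τ t with rfl | hτt
  · filter_upwards [self_mem_nhdsWithin] with u hu
    rcases eq_or_ne u τ with rfl | huτ
    · simp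
    obtain ⟨hu₁, hu₂⟩ := hAB u hu huτ
    simp only [jumpPropagator, if_neg huτ, if_true]
    calc ‖(1 + (A u - B)) * (1 + (B - A τ)) - 1 - (A u - A τ) • (1 : R)‖
        = ‖(A u - B) * (B - A τ)‖ := by rw [smul_eq_mul]; congr 1; noncomm_ring
      _ ≤ η * |μ u - μ τ| := (norm_mul_le _ _).trans (by gcongr)
      _ ≤ η * (1 + ‖1 + (B - A τ)‖) * |μ u - μ τ| := by
        gcongr
        exact le_mul_of_one_le_right hη (le_add_of_nonneg_right (norm_nonneg _))
  · filter_upwards [self_mem_nhdsWithin,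
      nhdsWithin_le_nhds (isOpen_ne.mem_nhds hτt)] with u hu hut
    obtain ⟨hτ₁, -⟩ := hAB τ hτ hτt
    simp only [jumpPropagator, if_neg hτt, if_neg (show u ≠ t from hut)]
    calc ‖(1 + (A u - B)) * (1 + (B - A t)) - (1 + (A τ - B)) * (1 + (B - A t))
            - (A u - A τ) • ((1 + (A τ - B)) * (1 + (B - A t)))‖
        = ‖(A u - A τ) * ((A τ - B) * (1 + (B - A t)))‖ := by
          rw [← norm_neg, smul_eq_mul]; congr 1; noncomm_ring
      _ ≤ |μ u - μ τ| * (η * ‖1 + (B - A t)‖) := by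
          refine (norm_mul_le _ _).trans (mul_le_mul (hA.norm_sub_le τ hτ u hu) ?_
            (norm_nonneg _) (abs_nonneg _))
          exact (norm_mul_le _ _).trans (by gcongr)
      _ ≤ η * (1 + ‖1 + (B - A t)‖) * |μ u - μ τ| := by
          rw [mul_comm]
          gcongr
          exact le_add_of_nonneg_left zero_le_one

theorem HasIncrementBound.norm_limit_sub_le {X : Type*} [NormedAddCommGroup X] {A : ℝ → X} {B : X}
    (hA : HasIncrementBound A μ J) (ht : t ∈ J) (hl : IsSide l t) (hJ : J ∈ l)
    (hB : Tendsto A l (𝓝 B)) : ∀ᶠ u in l, ‖B - A t‖ ≤ |μ u - μ t| := by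
  have := hl.neBot
  filter_upwards [hl.eventually_uIcc_mem] with u hu
  refine le_of_tendsto (hB.sub_const (A t)).norm ?_
  filter_upwards [hu, hJ] with w hwu hwJ
  exact (hA.norm_sub_le t ht w hwJ).trans
    (abs_sub_left_of_mem_uIcc (hA.monotone.image_uIcc_subset (mem_image_of_mem μ hwu)))

theorem eventually_exists_isApproxSolutionOn_uIcc [CompleteSpace R] (hA : HasIncrementBound A μ J)
    (hD : HasInvertibleJumps A J) (ht : t ∈ J) (hl : IsSide l t) (hJ : J ∈ l) {D : ℝ}
    (hDn : 0 ≤ D) (hε : 0 < ε) :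
    ∀ᶠ v in l, ∀ y : M, ‖y‖ ≤ D →
      (∃ x, IsApproxSolutionOn A μ ε (uIcc t v) x ∧ x t = y) ∧
        ∃ x, IsApproxSolutionOn A μ ε (uIcc t v) x ∧ x v = y := by
  obtain ⟨B, hB, hU⟩ := hD t ht l hl hJ
  have hΦ : Tendsto (jumpPropagator A B t) l (𝓝 (1 + (B - A t))) := by
    have : Tendsto (fun u => (1 + (A u - B)) * (1 + (B - A t))) l (𝓝 (1 + (B - A t))) := by
      have h := (tendsto_const_nhds (x := (1 : R))).add (hB.sub_const B)
      simpa using h.mul_const (1 + (B - A t))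
    exact this.congr' (hl.eventually_ne.mono fun u hu => (if_neg hu).symm)
  obtain ⟨K, hK, hinv⟩ := exists_eventually_inverse_norm_le hΦ hU
  obtain ⟨η, hη, hηε⟩ := exists_pos_mul_lt hε ((1 + ‖1 + (B - A t)‖) * ((1 + K) * D))
  have hAB : ∀ᶠ u in l, u ∈ J ∧ ‖A u - B‖ ≤ η ∧ ‖B - A t‖ ≤ |μ u - μ t| :=
    Filter.Eventually.and hJ <| (((tendsto_iff_norm_sub_tendsto_zero.1 hB).eventually_le_const
      hη)).and (hA.norm_limit_sub_le ht hl hJ hB)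
  filter_upwards [hl.eventually_forall_uIcc hAB, hinv] with v hv ⟨S, hS, _, hSK⟩
  have hJv : uIcc t v ⊆ J := fun u hu => by
    rcases eq_or_ne u t with rfl | hut
    exacts [ht, (hv u hu hut).1]
  have hΦv := isApproxSolutionOn_jumpPropagator hη.le (hA.mono hJv) fun u hu hut => (hv u hu hut).2
  have hscale : ∀ w : M, ‖w‖ ≤ (1 + K) * D →
      IsApproxSolutionOn A μ ε (uIcc t v) fun u => jumpPropagator A B t u • w := fun w hw => by
    refine (hΦv.smul_const w).of_le (le_trans ?_ hηε.le)
    rw [mul_comm η, mul_right_comm]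
    gcongr
  intro y hy
  refine ⟨⟨_, hscale y ?_, by simp [jumpPropagator]⟩,
    ⟨_, hscale (S • y) ?_, by rw [smul_smul, hS, one_smul]⟩⟩
  · exact hy.trans (le_mul_of_one_le_left hDn (by linarith))
  · exact (norm_smul_le _ _).trans (mul_le_mul (hSK.trans (by linarith)) hy (norm_nonneg _)
      (by positivity))

theorem mem_uIcc_or_mem_uIcc_of_mem_uIcc {u v : ℝ} (hu : u ∈ uIcc s t) (hv : v ∈ uIcc s t) :
    v ∈ uIcc s u ∨ u ∈ uIcc s v := by
  simp only [mem_uIcc] at *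
  grind

theorem exists_isApproxSolutionOn_uIcc [CompleteSpace R] (hA : HasIncrementBound A μ (uIcc s t))
    (hD : HasInvertibleJumps A (uIcc s t)) (hε : 0 < ε) (y : M) :
    ∃ x, IsApproxSolutionOn A μ ε (uIcc s t) x ∧ x s = y := by
  obtain ⟨C, hC⟩ := exists_isGrowthBound (M := M) hA hD
  let E : ℝ → Prop := fun u => ∃ x, IsApproxSolutionOn A μ ε (uIcc s u) x ∧ x s = y
  have hDn : 0 ≤ C * (‖y‖ + ε) := mul_nonneg hC.nonneg (by positivity)
  have extend : ∀ u ∈ uIcc s t, ∀ v ∈ uIcc s t, (∀ w : M, ‖w‖ ≤ C * (‖y‖ + ε) →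
      ∃ z, IsApproxSolutionOn A μ ε (uIcc u v) z ∧ z u = w) → E u → E v := by
    rintro u hu v hv hloc ⟨x, hx, rfl⟩
    rcases mem_uIcc_or_mem_uIcc_of_mem_uIcc hu hv with hvu | huv
    · exact ⟨x, hx.mono (uIcc_subset_uIcc_left hvu), rfl⟩
    · obtain ⟨z, hz, hzu⟩ := hloc (x u) (hC.norm_le s left_mem_uIcc u hu ε hε.le x hx)
      exact hx.exists_extend hz hzu huv
  have local_iff : ∀ τ ∈ uIcc s t, ∀ l, IsSide l τ → uIcc s t ∈ l → ∀ᶠ v in l, (E τ ↔ E v) := by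
    intro τ hτ l hl hJ
    filter_upwards [eventually_exists_isApproxSolutionOn_uIcc (M := M) hA hD hτ hl hJ hDn hε,
      hJ] with v hv hvJ
    exact ⟨extend τ hτ v hvJ fun w hw => (hv w hw).1,
      extend v hvJ τ hτ fun w hw => uIcc_comm τ v ▸ (hv w hw).2⟩
  have hEs : E s := ⟨fun _ => y, by rw [uIcc_self]; exact isApproxSolutionOn_singleton s _, rfl⟩
  have hE : E (s ⊓ t) ↔ E (s ⊔ t) := interval_induction (P := fun u v => E u ↔ E v) inf_le_sup
    Iff.rfl (fun _ _ _ _ _ _ _ => Iff.trans)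
    (fun τ hτ => (local_iff τ (Ioc_subset_Icc_self hτ) _ (isSide_left τ)
      (Icc_mem_nhdsLT_of_mem hτ)).mono fun _ => Iff.symm)
    fun τ hτ => local_iff τ (Ico_subset_Icc_self hτ) _ (isSide_right τ) (Icc_mem_nhdsGT_of_mem hτ)
  rcases le_total s t with hst | hst
  · rw [inf_of_le_left hst, sup_of_le_right hst] at hE
    exact hE.1 hEs
  · rw [inf_of_le_right hst, sup_of_le_left hst] at hE
    exact hE.2 hEs

theorem isApproxSolutionOn_of_norm_le {S L : ℝ} (hA : HasIncrementBound A μ J)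
    (hS : ∀ t ∈ J, ‖x t‖ ≤ S) (hL : ∀ u ∈ J, ∀ v ∈ J, ‖x v - x u‖ ≤ L * |μ v - μ u|) :
    IsApproxSolutionOn A μ (L + S) J x := fun τ hτ => by
  filter_upwards [self_mem_nhdsWithin] with u hu
  calc ‖x u - x τ - (A u - A τ) • x τ‖ ≤ L * |μ u - μ τ| + |μ u - μ τ| * S := by
        refine norm_sub_le_of_le (hL τ hτ u hu) ((norm_smul_le _ _).trans ?_)
        exact mul_le_mul (hA.norm_sub_le τ hτ u hu) (hS τ hτ) (norm_nonneg _) (abs_nonneg _)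
    _ = (L + S) * |μ u - μ τ| := by ring

/-- The error of the limit is controlled by comparing it with one approximation: the growth bound
makes the differences of the approximations small together with their increments. -/
theorem exists_isLocalSolutionOn_of_isApproxSolutionOn [CompleteSpace M] [J.OrdConnected]
    (hA : HasIncrementBound A μ J) {C : ℝ} (hC : IsGrowthBound M A μ C J) (hs : s ∈ J)
    {x : ℕ → ℝ → M} {e : ℕ → ℝ} (he : Tendsto e atTop (𝓝 0)) (he₀ : ∀ n, 0 ≤ e n)
    (hx : ∀ n, IsApproxSolutionOn A μ (e n) J (x n)) (hxs : ∀ n k, x n s = x k s) :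
    ∃ z, IsLocalSolutionOn A μ J z ∧ z s = x 0 s := by
  have hdiff : ∀ n k, ∀ t ∈ J, ‖x n t - x k t‖ ≤ C * (e n + e k) := fun n k t ht => by
    have hst : uIcc s t ⊆ J := OrdConnected.uIcc_subset ‹_› hs ht
    exact hC.norm_sub_le hs ht (he₀ n) (he₀ k) ((hx n).mono hst) ((hx k).mono hst) (hxs n k)
  have hincr : ∀ n k, ∀ u ∈ J, ∀ v ∈ J, ‖(x n v - x k v) - (x n u - x k u)‖ ≤
      (C * (e n + e k) + (e n + e k)) * |μ v - μ u| := fun n k u hu v hv =>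
    ((hx n).sub (hx k)).norm_sub_le hA (hdiff n k) hu hv
  have hlim : ∀ n, Tendsto (fun k => e n + e k) atTop (𝓝 (e n)) := fun n => by
    simpa using he.const_add (e n)
  have hcauchy : ∀ t ∈ J, ∃ z, Tendsto (fun n => x n t) atTop (𝓝 z) := fun t ht => by
    refine cauchySeq_tendsto_of_complete (cauchySeq_iff_tendsto_dist_atTop_0.2 ?_)
    have he' : Tendsto (fun p : ℕ × ℕ => C * (e p.1 + e p.2)) atTop (𝓝 0) := by
      rw [← prod_atTop_atTop_eq]
      simpa using ((he.comp tendsto_fst).add (he.comp tendsto_snd)).const_mul C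
    exact squeeze_zero (fun _ => dist_nonneg)
      (fun p => (dist_eq_norm _ _).trans_le (hdiff p.1 p.2 t ht)) he'
  choose! z hz using hcauchy
  refine ⟨z, fun ε hε => ?_, tendsto_nhds_unique (hz s hs)
    (tendsto_const_nhds.congr fun n => hxs 0 n)⟩
  have hxz : ∀ n, IsApproxSolutionOn A μ ((C * e n + e n) + C * e n) J fun t => x n t - z t :=
    fun n => isApproxSolutionOn_of_norm_le hA
      (fun t ht => le_of_tendsto_of_tendsto' ((hz t ht).const_sub _).norm
        ((hlim n).const_mul C) fun k => hdiff n k t ht)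
      fun u hu v hv => le_of_tendsto_of_tendsto'
        (((hz v hv).const_sub _).sub ((hz u hu).const_sub _)).norm
        ((((hlim n).const_mul C).add (hlim n)).mul_const _) fun k => hincr n k u hu v hv
  have herr : Tendsto (fun n => e n + ((C * e n + e n) + C * e n)) atTop (𝓝 0) := by
    simpa using he.add (((he.const_mul C).add he).add (he.const_mul C))
  obtain ⟨n, hn⟩ := (herr.eventually_le_const hε).exists
  exact (((hx n).sub (hxz n)).congr fun t _ => sub_sub_cancel _ _).of_le hn

theorem exists_isLocalSolutionOn_uIcc [CompleteSpace R] [CompleteSpace M]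
    (hA : HasIncrementBound A μ (uIcc s t)) (hD : HasInvertibleJumps A (uIcc s t)) (y : M) :
    ∃ x, IsLocalSolutionOn A μ (uIcc s t) x ∧ x s = y := by
  obtain ⟨C, hC⟩ := exists_isGrowthBound (M := M) hA hD
  have happrox : ∀ n : ℕ, ∃ x, IsApproxSolutionOn A μ (1 / ((n : ℝ) + 1)) (uIcc s t) x ∧ x s = y :=
    fun n => exists_isApproxSolutionOn_uIcc hA hD Nat.one_div_pos_of_nat y
  choose x hx hxs using happrox
  obtain ⟨z, hz, hzs⟩ := exists_isLocalSolutionOn_of_isApproxSolutionOn hA hC left_mem_uIcc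
    tendsto_one_div_add_atTop_nhds_zero_nat (fun n => Nat.one_div_pos_of_nat.le) hx
    fun n k => (hxs n).trans (hxs k).symm
  exact ⟨z, hz, hzs.trans (hxs 0)⟩

theorem exists_isLocalSolutionOn [CompleteSpace R] [CompleteSpace M] [J.OrdConnected]
    (hA : HasIncrementBound A μ J) (hD : HasInvertibleJumps A J) (hs : s ∈ J) (y : M) :
    ∃ x, IsLocalSolutionOn A μ J x ∧ x s = y := by
  have hJ : ∀ t ∈ J, uIcc s t ⊆ J := fun t ht => OrdConnected.uIcc_subset ‹_› hs ht
  have hloc : ∀ t ∈ J, ∃ x : ℝ → M, IsLocalSolutionOn A μ (uIcc s t) x ∧ x s = y := fun t ht =>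
    exists_isLocalSolutionOn_uIcc (hA.mono (hJ t ht)) (hD.mono (hJ t ht)) y
  choose! X hX hXs using hloc
  have hglue : ∀ t ∈ J, EqOn (X t) (fun u => X u u) (uIcc s t) := fun t ht u hu => by
    have hut : uIcc s u ⊆ uIcc s t := uIcc_subset_uIcc_left hu
    have huJ : u ∈ J := hJ t ht hu
    exact IsLocalSolutionOn.eqOn (hA.mono (hJ u huJ)) (hD.mono (hJ u huJ))
      ((hX t ht).mono hut) (hX u huJ) left_mem_uIcc
      ((hXs t ht).trans (hXs u huJ).symm) right_mem_uIcc
  exact ⟨fun u => X u u, fun ε hε => .of_forall_uIcc fun t ht =>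
    (hX t ht ε hε).congr (hglue t ht), hXs s hs⟩

end Existence

section KurzweilSolutions

variable [IsBoundedSMul R M] {A : ℝ → R} {μ : ℝ → ℝ} {J : Set ℝ} {x : ℝ → M} {a b : ℝ}

theorem HasKurzweilIntegral.norm_sub_smul_le {C : ℝ} {y I : M} (hab : a ≤ b)
    (hA : HasIncrementBound A μ (Icc a b))
    (h : HasKurzweilIntegral (fun τ t => A t • x τ) a b I)
    (hC : ∀ t ∈ Icc a b, ‖x t - y‖ ≤ C) : ‖I - (A b - A a) • y‖ ≤ C * (μ b - μ a) := by
  refine le_of_forall_pos_le_add fun ε hε => ?_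
  obtain ⟨P, -, hP⟩ := h.exists_isFine hab (δ := fun _ => 1) (fun _ _ => one_pos) hε
  have hj : ∀ j < P.ν, ‖A (P.pt (j + 1)) • x (P.tag j) - A (P.pt j) • x (P.tag j) -
      (A (P.pt (j + 1)) • y - A (P.pt j) • y)‖ ≤ C * μ (P.pt (j + 1)) - C * μ (P.pt j) := by
    intro j hj
    have hA' := hA.norm_sub_le _ (P.pt_mem_Icc hj.le) _ (P.pt_mem_Icc (j := j + 1) hj)
    rw [abs_of_nonneg (sub_nonneg.2 (hA.monotone (P.pt_lt j hj).le))] at hA'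
    rw [← sub_smul, ← sub_smul, ← smul_sub, ← mul_sub, mul_comm]
    exact (norm_smul_le _ _).trans (mul_le_mul hA' (hC _ (P.tag_mem_Icc hj)) (norm_nonneg _)
      ((norm_nonneg _).trans hA'))
  have hsum := P.norm_kurzweilSum_sub_le (G := fun τ t => A t • x τ) (F := fun t => A t • y)
    (m := fun t => C * μ t) hj
  rw [← sub_smul, ← mul_sub] at hsum
  rw [add_comm]
  exact (norm_sub_le_norm_sub_add_norm_sub _ _ _).trans
    (add_le_add ((norm_sub_rev _ _).trans_le hP.le) hsum)

theorem IsKurzweilPrimitiveOn.norm_sub_smul_le {C u v : ℝ} {y : M} (hA : HasIncrementBound A μ J)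
    (h : IsKurzweilPrimitiveOn (fun τ t => A t • x τ) J x) (huv : uIcc u v ⊆ J)
    (hC : ∀ t ∈ uIcc u v, ‖x t - y‖ ≤ C) :
    ‖x v - x u - (A v - A u) • y‖ ≤ C * |μ v - μ u| := by
  wlog hle : u ≤ v generalizing u v
  · rw [← norm_neg, abs_sub_comm, neg_sub', neg_sub, ← neg_smul, neg_sub]
    rw [uIcc_comm] at huv hC
    exact this huv hC (le_of_not_ge hle)
  rw [uIcc_of_le hle] at huv hC
  rw [abs_of_nonneg (sub_nonneg.2 (hA.monotone hle))]
  exact (h u v hle huv).norm_sub_smul_le hle (hA.mono huv) hC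

theorem IsKurzweilPrimitiveOn.exists_norm_le (hA : HasIncrementBound A μ (Icc a b))
    (h : IsKurzweilPrimitiveOn (fun τ t => A t • x τ) (Icc a b) x) :
    ∃ S, ∀ t ∈ Icc a b, ‖x t‖ ≤ S := by
  refine isCompact_Icc.induction_on (p := fun s => ∃ S, ∀ t ∈ s, ‖x t‖ ≤ S)
    ⟨0, fun _ ht => ht.elim⟩ (fun _ _ hst ⟨S, hS⟩ => ⟨S, fun t ht => hS t (hst ht)⟩) ?_
    fun τ hτ => ?_
  · rintro s t ⟨S, hS⟩ ⟨S', hS'⟩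
    exact ⟨max S S', fun u hu => hu.elim (fun hu => le_max_of_le_left (hS u hu))
      fun hu => le_max_of_le_right (hS' u hu)⟩
  obtain ⟨S, hS⟩ : ∃ S, ∀ᶠ u in 𝓝[Icc a b] τ, ‖x u - A u • x τ‖ ≤ S :=
    ⟨_, (h.tendsto hτ).norm.eventually_le_const (lt_add_one _)⟩
  refine ⟨_, inter_mem hS self_mem_nhdsWithin, S + (‖A τ‖ + |μ b - μ a|) * ‖x τ‖, ?_⟩
  rintro u ⟨hu : ‖x u - A u • x τ‖ ≤ S, huab⟩
  have hAu : ‖A u‖ ≤ ‖A τ‖ + |μ b - μ a| := by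
    refine (norm_le_norm_add_norm_sub' (A u) (A τ)).trans ?_
    gcongr
    refine (hA.norm_sub_le τ hτ u huab).trans ((abs_sub_le_of_le_of_le (hA.monotone huab.1)
      (hA.monotone huab.2) (hA.monotone hτ.1) (hA.monotone hτ.2)).trans (le_abs_self _))
  calc ‖x u‖ ≤ ‖x u - A u • x τ‖ + ‖A u • x τ‖ := by
        rw [add_comm]; exact norm_le_norm_add_norm_sub' _ _
    _ ≤ S + (‖A τ‖ + |μ b - μ a|) * ‖x τ‖ :=
      add_le_add hu ((norm_smul_le _ _).trans (by gcongr))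

/-- At a jump of `A` a solution `x` is not close to `x τ`, so the increment from `τ` cannot be
estimated directly; it is the limit of the increments from points `r` beyond the jump, since
`x r - A r • x τ` tends to `x τ - A τ • x τ`. -/
theorem IsKurzweilPrimitiveOn.eventually_norm_sub_smul_le {τ ε : ℝ} {l : Filter ℝ}
    [J.OrdConnected] (hA : HasIncrementBound A μ J)
    (h : IsKurzweilPrimitiveOn (fun τ t => A t • x τ) J x) (hτ : τ ∈ J) (hl : IsSide l τ)
    (hJ : J ∈ l) (hε : 0 < ε) :
    ∀ᶠ u in l, ‖x u - x τ - (A u - A τ) • x τ‖ ≤ ε * |μ u - μ τ| := by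
  have := hl.neBot
  obtain ⟨p, hpl, hp⟩ := (hl.eventually_uIcc_mem.and hJ).exists
  have hpJ : uIcc τ p ⊆ J := OrdConnected.uIcc_subset ‹_› hτ hp
  obtain ⟨S, hS⟩ := IsKurzweilPrimitiveOn.exists_norm_le (hA.mono hpJ) (h.mono hpJ)
  have hlip : ∀ u ∈ uIcc τ p, ‖x u - x τ‖ ≤ S * |μ u - μ τ| := fun u hu => by
    have hu' : uIcc τ u ⊆ uIcc τ p := uIcc_subset_uIcc_left hu
    simpa only [smul_zero, sub_zero] using
      h.norm_sub_smul_le (y := 0) hA (hu'.trans hpJ) fun t ht => by simpa using hS t (hu' ht)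
  obtain ⟨m, hm⟩ := hl.exists_tendsto hA.monotone
  have hsmall : ∀ᶠ u in l, S * |μ u - m| ≤ ε :=
    (tendsto_iff_norm_sub_tendsto_zero.1 hm).const_mul S |>.eventually_le_const (by simpa)
  have hS₀ : 0 ≤ S := (norm_nonneg _).trans (hS τ left_mem_uIcc)
  filter_upwards [hsmall, hpl, hl.eventually_uIcc_mem] with u hu hup hul
  have hbeyond : ∀ᶠ r in l, ‖x u - (x r - A r • x τ) - A u • x τ‖ ≤
      S * |μ u - μ τ| * |μ u - μ r| := by
    filter_upwards [hul] with r hr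
    have hru : uIcc r u ⊆ uIcc τ u := uIcc_subset_uIcc_right hr
    rw [show x u - (x r - A r • x τ) - A u • x τ = x u - x r - (A u - A r) • x τ by
      rw [sub_smul]; abel]
    refine h.norm_sub_smul_le hA (hru.trans ((uIcc_subset_uIcc_left hup).trans hpJ))
      fun t ht => (hlip t (uIcc_subset_uIcc_left hup (hru ht))).trans ?_
    gcongr S * ?_
    exact abs_sub_left_of_mem_uIcc (hA.monotone.image_uIcc_subset (mem_image_of_mem μ (hru ht)))
  have hlim := le_of_tendsto_of_tendsto
    ((((h.mono hpJ).tendsto left_mem_uIcc).mono_left (hl.le_nhdsWithin hpl)).const_sub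
      (x u) |>.sub_const (A u • x τ)).norm ((hm.const_sub (μ u)).abs.const_mul _) hbeyond
  calc ‖x u - x τ - (A u - A τ) • x τ‖ = ‖x u - (x τ - A τ • x τ) - A u • x τ‖ := by
        rw [sub_smul]; congr 1; abel
    _ ≤ S * |μ u - μ τ| * |μ u - m| := hlim
    _ ≤ ε * |μ u - μ τ| := by rw [mul_right_comm]; gcongr

theorem isKurzweilPrimitiveOn_iff_isLocalSolutionOn [J.OrdConnected]
    (hA : HasIncrementBound A μ J) :
    IsKurzweilPrimitiveOn (fun τ t => A t • x τ) J x ↔ IsLocalSolutionOn A μ J x := by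
  refine ⟨fun h ε hε τ hτ => eventually_nhdsWithin_of_forall_isSide hτ (by simp)
    fun l hl hJ => h.eventually_norm_sub_smul_le hA hτ hl hJ hε, fun h c d _ hcd => ?_⟩
  refine hasKurzweilIntegral_of_eventually_norm_sub_le hA.monotone fun ε hε τ hτ => ?_
  simpa only [sub_smul] using (h ε hε).mono hcd τ hτ

end KurzweilSolutions

end LinearEquation

/-! ### The transition matrix -/

section Transition

variable {E : Type*} [NormedAddCommGroup E] [NormedSpace ℝ E] {A : ℝ → E →L[ℝ] E} {μ : ℝ → ℝ}

instance isBoundedSMul_continuousLinearMap : IsBoundedSMul (E →L[ℝ] E) E :=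
  .of_norm_smul_le fun T v => T.le_opNorm v

theorem isSolutionOn_iff_isLocalSolutionOn {J : Set ℝ} [J.OrdConnected] {x : ℝ → E}
    (hA : HasIncrementBound A μ J) : IsSolutionOn A J x ↔ IsLocalSolutionOn A μ J x :=
  isKurzweilPrimitiveOn_iff_isLocalSolutionOn hA

theorem exists_hasIncrementBound {X : Type*} [NormedAddCommGroup X] {A : ℝ → X}
    (hA : LocallyBoundedVariationOn A (Ici 0)) : ∃ μ, HasIncrementBound A μ (Ici 0) := by
  have h0 : (0 : ℝ) ∈ Ici (0 : ℝ) := self_mem_Ici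
  have hmax : ∀ t : ℝ, max t 0 ∈ Ici (0 : ℝ) := fun t => le_max_right t 0
  have hμ : Monotone fun t => variationOnFromTo A (Ici 0) 0 (max t 0) := fun u v huv =>
    variationOnFromTo.monotoneOn hA h0 (hmax u) (hmax v) (max_le_max_right 0 huv)
  refine ⟨_, hμ, fun u hu v hv => ?_⟩
  wlog huv : u ≤ v generalizing u v
  · rw [norm_sub_rev, abs_sub_comm]
    exact this v hv u hu (le_of_not_ge huv)
  rw [abs_of_nonneg (sub_nonneg.2 (hμ huv))]
  beta_reduce
  rw [max_eq_left (mem_Ici.1 hu), max_eq_left (mem_Ici.1 hv),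
    ← variationOnFromTo.add hA h0 hu hv, add_sub_cancel_left, variationOnFromTo.eq_of_le _ _ huv,
    ← dist_eq_norm, dist_comm, dist_edist]
  exact ENNReal.toReal_mono (hA _ _ hu hv)
    (eVariationOn.edist_le A ⟨hu, le_rfl, huv⟩ ⟨hv, huv, le_rfl⟩)

theorem HasIncrementBound.exists_tendsto {X : Type*} [NormedAddCommGroup X] [CompleteSpace X]
    {A : ℝ → X} {J : Set ℝ} (hA : HasIncrementBound A μ J) {l : Filter ℝ} {t : ℝ}
    (hl : IsSide l t) (hJ : J ∈ l) : ∃ B, Tendsto A l (𝓝 B) := by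
  have := hl.neBot
  obtain ⟨m, hm⟩ := hl.exists_tendsto hA.monotone
  have hmm : Tendsto (fun p : ℝ × ℝ => |μ p.1 - μ p.2|) (l ×ˢ l) (𝓝 0) := by
    simpa using ((hm.comp tendsto_fst).sub (hm.comp tendsto_snd)).abs
  refine cauchy_map_iff_exists_tendsto.1 (cauchy_map_iff'.2
    (tendsto_uniformity_iff_dist_tendsto_zero.2 (squeeze_zero' (.of_forall fun _ => dist_nonneg)
      ?_ hmm)))
  filter_upwards [prod_mem_prod hJ hJ] with p hp
  exact (dist_eq_norm _ _).trans_le (hA.norm_sub_le _ hp.2 _ hp.1)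

theorem ConditionD.hasInvertibleJumps [CompleteSpace E] (hD : ConditionD A)
    (hA : HasIncrementBound A μ (Ici 0)) : HasInvertibleJumps A (Ici 0) := by
  intro t ht l hl hJ
  obtain ⟨B, hB⟩ := hA.exists_tendsto hl hJ
  refine ⟨B, hB, ?_⟩
  rcases hl with rfl | rfl
  · have ht' : 0 < t := by
      by_contra hle
      obtain ⟨u, hu, hut⟩ := (Filter.Eventually.and hJ self_mem_nhdsWithin).exists
      exact hle ((mem_Ici.1 hu).trans_lt hut)
    have h := hD.1 t ht'
    rwa [leftLim_eq_of_tendsto hB, sub_eq_add_neg, neg_sub] at h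
  · have h := hD.2 t ht
    rwa [rightLim_eq_of_tendsto hB] at h

theorem isTransitionMatrix_iff (hA : HasIncrementBound A μ (Ici 0)) {U : ℝ → ℝ → E →L[ℝ] E} :
    IsTransitionMatrix A U ↔
      ∀ s ≥ 0, IsLocalSolutionOn A μ (Ici 0) (fun t => U t s) ∧ U s s = 1 := by
  refine ⟨fun h s hs => ?_, fun h t s ht hs => ?_⟩
  · have hss : U s s = 1 := sub_eq_zero.1 ((h s s hs hs).1 le_rfl).eq_zero_of_refl
    refine ⟨fun ε hε => .of_forall_uIcc (s := s) fun t ht => ?_, hss⟩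
    have hst : uIcc s t ⊆ Ici 0 := OrdConnected.uIcc_subset ordConnected_Ici hs ht
    refine (isKurzweilPrimitiveOn_iff_isLocalSolutionOn (hA.mono hst)).1
      (isKurzweilPrimitiveOn_uIcc fun u hu => ?_) ε hε
    rw [hss]
    exact h u s (hst hu) hs
  · obtain ⟨hU, hss⟩ := h s hs
    have hint := ((isKurzweilPrimitiveOn_iff_isLocalSolutionOn hA).2 hU).hasOrientedKurzweilIntegral
      hs ht
    rwa [hss] at hint

theorem exists_isTransitionMatrix [CompleteSpace E] (hA : HasIncrementBound A μ (Ici 0))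
    (hD : HasInvertibleJumps A (Ici 0)) : ∃ U, IsTransitionMatrix A U := by
  have hU : ∀ s ≥ 0, ∃ Φ : ℝ → E →L[ℝ] E, IsLocalSolutionOn A μ (Ici 0) Φ ∧ Φ s = 1 :=
    fun s hs => exists_isLocalSolutionOn hA hD hs 1
  choose! U hU using hU
  exact ⟨fun t s => U s t, (isTransitionMatrix_iff hA).2 hU⟩

theorem IsTransitionMatrix.eq [CompleteSpace E] {U V : ℝ → ℝ → E →L[ℝ] E}
    (hU : IsTransitionMatrix A U) (hV : IsTransitionMatrix A V) (hA : HasIncrementBound A μ (Ici 0))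
    (hD : HasInvertibleJumps A (Ici 0)) {s t : ℝ} (hs : 0 ≤ s) (ht : 0 ≤ t) : V t s = U t s := by
  obtain ⟨hUs, hU₁⟩ := (isTransitionMatrix_iff hA).1 hU s hs
  obtain ⟨hVs, hV₁⟩ := (isTransitionMatrix_iff hA).1 hV s hs
  exact hVs.eqOn hA hD hUs hs (hV₁.trans hU₁.symm) ht

theorem IsTransitionMatrix.isSolutionOn_apply {U : ℝ → ℝ → E →L[ℝ] E}
    (hU : IsTransitionMatrix A U) (hA : HasIncrementBound A μ (Ici 0)) {s : ℝ} (hs : 0 ≤ s)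
    (v : E) : IsSolutionOn A (Ici s) fun t => U t s v :=
  have hJ : Ici s ⊆ Ici 0 := Ici_subset_Ici.2 hs
  (isSolutionOn_iff_isLocalSolutionOn (hA.mono hJ)).2
    ((((isTransitionMatrix_iff hA).1 hU s hs).1.smul_const v).mono hJ)

theorem IsTransitionMatrix.apply_eq [CompleteSpace E] {U : ℝ → ℝ → E →L[ℝ] E}
    (hU : IsTransitionMatrix A U) (hA : HasIncrementBound A μ (Ici 0))
    (hD : HasInvertibleJumps A (Ici 0)) {s t : ℝ} (hs : 0 ≤ s) (hst : s ≤ t) {x : ℝ → E}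
    (hx : IsSolutionOn A (Ici s) x) : U t s (x s) = x t := by
  have hJ : Ici s ⊆ Ici 0 := Ici_subset_Ici.2 hs
  refine IsLocalSolutionOn.eqOn (hA.mono hJ) (hD.mono hJ)
    ((isSolutionOn_iff_isLocalSolutionOn (hA.mono hJ)).1 (hU.isSolutionOn_apply hA hs (x s)))
    ((isSolutionOn_iff_isLocalSolutionOn (hA.mono hJ)).1 hx) self_mem_Ici ?_ hst
  rw [((isTransitionMatrix_iff hA).1 hU s hs).2, one_apply_eq_self]

theorem IsTransitionMatrix.uniformlyStable_iff [CompleteSpace E] {U : ℝ → ℝ → E →L[ℝ] E}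
    (hU : IsTransitionMatrix A U) (hA : HasIncrementBound A μ (Ici 0))
    (hD : HasInvertibleJumps A (Ici 0)) :
    UniformlyStable A ↔ ∃ C : ℝ, ∀ t s₀ : ℝ, 0 ≤ s₀ → s₀ ≤ t → ‖U t s₀‖ ≤ C := by
  constructor
  · intro h
    obtain ⟨δ, hδ, H⟩ := h 1 one_pos
    have hc : ‖(1 / 2 : ℝ)‖ = 1 / 2 := by norm_num
    refine ⟨2 / δ, fun t s hs hst => ContinuousLinearMap.opNorm_le_of_shell' (c := (1 / 2 : ℝ)) hδ
      (by positivity) (hc.trans_lt one_half_lt_one) fun v hδv hvδ => ?_⟩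
    have hUss : U s s v = v := by
      rw [((isTransitionMatrix_iff hA).1 hU s hs).2, one_apply_eq_self]
    calc ‖U t s v‖ ≤ 1 := (H s hs v hvδ _ (hU.isSolutionOn_apply hA hs v) hUss t hst).le
      _ ≤ 2 / δ * ‖v‖ := by
        rw [hc] at hδv
        rw [div_mul_eq_mul_div, le_div_iff₀ hδ]
        linarith
  · rintro ⟨C, hC⟩ ε hε
    obtain ⟨δ, hδ, hδε⟩ := exists_pos_mul_lt hε C
    refine ⟨δ, hδ, fun s hs x₀ hx₀ x hx hxs t hst => ?_⟩
    have hC₀ : 0 ≤ C := (norm_nonneg _).trans (hC s s hs le_rfl)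
    calc ‖x t‖ = ‖U t s x₀‖ := by rw [← hxs, hU.apply_eq hA hD hs hst hx]
      _ ≤ C * ‖x₀‖ := (U t s).le_of_opNorm_le (hC t s hs hst) x₀
      _ ≤ C * δ := by gcongr
      _ < ε := hδε

end Transition

end GLDE

theorem theorem3p1_general {E : Type*} [NormedAddCommGroup E] [NormedSpace ℝ E] [CompleteSpace E]
    (A : ℝ → E →L[ℝ] E) (hA : LocallyBoundedVariationOn A (Set.Ici 0))
    (hD : GLDE.ConditionD A) :
    ∃ U : ℝ → ℝ → E →L[ℝ] E,
      GLDE.IsTransitionMatrix A U ∧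
      (∀ V : ℝ → ℝ → E →L[ℝ] E, GLDE.IsTransitionMatrix A V →
        ∀ t s : ℝ, 0 ≤ t → 0 ≤ s → V t s = U t s) ∧
      (GLDE.UniformlyStable A ↔ ∃ C : ℝ, ∀ t s₀ : ℝ, 0 ≤ s₀ → s₀ ≤ t → ‖U t s₀‖ ≤ C) := by
  obtain ⟨μ, hμ⟩ := GLDE.exists_hasIncrementBound hA
  have hJ : GLDE.HasInvertibleJumps A (Ici 0) := hD.hasInvertibleJumps hμ
  obtain ⟨U, hU⟩ := GLDE.exists_isTransitionMatrix hμ hJ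
  exact ⟨U, hU, fun V hV t s ht hs => hU.eq hV hμ hJ hs ht, hU.uniformlyStable_iff hμ hJ⟩

theorem theorem3p1 {E : Type*} [NormedAddCommGroup E] [NormedSpace ℝ E] [FiniteDimensional ℝ E]
    (A : ℝ → E →L[ℝ] E) (hA : LocallyBoundedVariationOn A (Set.Ici 0))
    (hD : GLDE.ConditionD A) :
    ∃ U : ℝ → ℝ → E →L[ℝ] E,
      GLDE.IsTransitionMatrix A U ∧
      (∀ V : ℝ → ℝ → E →L[ℝ] E, GLDE.IsTransitionMatrix A V →
        ∀ t s : ℝ, 0 ≤ t → 0 ≤ s → V t s = U t s) ∧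
      (GLDE.UniformlyStable A ↔ ∃ C : ℝ, ∀ t s₀ : ℝ, 0 ≤ s₀ → s₀ ≤ t → ‖U t s₀‖ ≤ C) := by
  have := FiniteDimensional.complete ℝ E
  exact theorem3p1_general A hA hD
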